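/- **Setting.** Let $I=(a,b)$ be a bounded interval, $a<b$. For real $t\ge 0$ let $H^t(I)$ be the usual ($L^2$-based) Sobolev space with norm $\|\cdot\|_t$ (for non-integer $t$, the Sobolev–Slobodeckij space), and let $H^1_E(I)=\{v\in H^1(I): v(a)=0\}$; pointwise values are those of continuous representatives. Let $a_2\ge a_{\min}>0$ and $a_0\ge 0$ a.e. on $I$, with $a_0\in L^\infty(I)$. For $f\in L^2(I)$ consider the problem $$-(a_2u')'+a_0u=f \ \text{ in } (a,b),\qquad u(a)=0,\quad u'(b)=0. \tag{1}$$ Let $a=x_1<x_2<\dots<x_N=b$ be a partition of $I$ with elements $I_i=(x_i,x_{i+1})$ and mesh size $h=\max_i(x_{i+1}-x_i)$. Let $k\ge 0$ be an integer and let $r=k+1$. The space $S_h$ consists of all $v$ made up of a polynomial $v^0|_{I_i}$ of degree at most $k$ on each element and of one value $v^i\in\mathbb R$ at each node $x_i$, with $v^1=0$; the nodal values need not be traces of $v^0$. The discrete weak derivative $d_{w,r}v$ of $v\in S_h$ is, on each $I_i$, the unique polynomial of degree at most $r$ such that $$\int_{I_i} d_{w,r}v\,q\,dx=-\int_{I_i}v^0q'\,dx+v^{i+1}q(x_{i+1})-v^iq(x_i)$$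 for all polynomials $q$ of degree at most $r$. Write $(v,w)_h=\sum_i\int_{I_i}vw\,dx$ and $\|v\|_h^2=(v,v)_h$. The scheme is: find $u_h\in S_h$ such that $$(a_2d_{w,r}u_h,d_{w,r}v)_h+(a_0u_h^0,v^0)_h=(f,v^0)_h\qquad\text{for all } v\in S_h. \tag{2}$$ **Theorem 4.4.** (i) Let $s$ be a real number with $0\le s\le k$ and let $a_2\in H^{1+s}(I)$. There is a constant $C>0$, independent of the partition (in particular of $h$), of $f$ and of $u$, such that for every $f\in L^2(I)$, every solution $u\in H^1_E(I)\cap H^{2+s}(I)$ of (1), every partition and every solution $u_h\in S_h$ of (2), $$\|d_{w,r}u_h-u'\|_h\le Ch^{s+1}\|u\|_{s+2},\qquad \max_{1\le i\le N}|u_h^i-u(x_i)|\le Ch^{s+1}\|u\|_{s+2}.$$ (ii) If $a_0=0$ and $a_2\in H^{k+2}(I)$, there is a constant $C>0$, with the same independence, such that for every $f\in L^2(I)$, every solution $u\in H^1_E(I)\cap H^{k+3}(I)$ of (1), every partition and every solution $u_h\in S_h$ of (2), $$\|d_{w,r}u_h-u'\|_h\le Ch^{k+2}\|u\|_{k+3},\qquad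 \max_{1\le i\le N}|u_h^i-u(x_i)|\le Ch^{k+2}\|u\|_{k+3}.$$ -/

import Mathlib

open MeasureTheory Set Polynomial
open scoped ENNReal ContDiff

noncomputable section

namespace WeakFE

/-! ### Sobolev spaces on a bounded interval -/

/-- Lebesgue measure on the open interval `(a, b)`. -/
abbrev vol (a b : ℝ) : Measure ℝ := volume.restrict (Ioo a b)

/-- `v` is a weak derivative of `u` on `(a, b)`: both are locally integrable and
`∫ u φ' = - ∫ v φ` for every test function `φ ∈ C_c^∞(a, b)`. -/
def HasWeakDeriv (a b : ℝ) (u v : ℝ → ℝ) : Prop :=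
  LocallyIntegrableOn u (Ioo a b) ∧ LocallyIntegrableOn v (Ioo a b) ∧
    ∀ φ : ℝ → ℝ, ContDiff ℝ ∞ φ → HasCompactSupport φ → tsupport φ ⊆ Ioo a b →
      ∫ x in Ioo a b, u x * deriv φ x = - ∫ x in Ioo a b, v x * φ x

open Classical in
/-- A representative of the weak derivative of `u` on `(a, b)` (the zero function if `u` is not
weakly differentiable); it is unique up to equality almost everywhere. -/
def weakDeriv (a b : ℝ) (u : ℝ → ℝ) : ℝ → ℝ :=
  if h : ∃ v, HasWeakDeriv a b u v then h.choose else 0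

/-- The `j`-th weak derivative. -/
def iterWeakDeriv (a b : ℝ) (j : ℕ) (u : ℝ → ℝ) : ℝ → ℝ :=
  (weakDeriv a b)^[j] u

/-- The squared Sobolev-Slobodeckij seminorm
`∫∫ |g x - g y|² / |x - y|^(1 + 2σ) dx dy` of order `σ ∈ (0, 1)` on `(a, b)`. -/
def slobodeckijSq (a b σ : ℝ) (g : ℝ → ℝ) : ℝ≥0∞ :=
  ∫⁻ x in Ioo a b, ∫⁻ y in Ioo a b,
    ENNReal.ofReal ((g x - g y) ^ 2 / |x - y| ^ (1 + 2 * σ))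

open Classical in
/-- The part of the squared `H^t` norm that comes from the fractional part of `t`: the squared
Slobodeckij seminorm of the derivative of order `⌊t⌋`, absent when `t` is an integer. -/
def fractionalPartSq (a b t : ℝ) (u : ℝ → ℝ) : ℝ≥0∞ :=
  if t = (⌊t⌋₊ : ℝ) then 0
  else slobodeckijSq a b (t - ⌊t⌋₊) (iterWeakDeriv a b ⌊t⌋₊ u)

/-- `u ∈ H^t(a, b)`, for real `t ≥ 0`: with `m = ⌊t⌋`, the function `u` has weak derivatives up to
order `m`, all in `L²(a, b)`, and, if `t` is not an integer, the `m`-th one has finite Slobodeckij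
seminorm of order `t - m`. -/
def MemSobolev (a b t : ℝ) (u : ℝ → ℝ) : Prop :=
  (∀ j < ⌊t⌋₊, ∃ v, HasWeakDeriv a b (iterWeakDeriv a b j u) v) ∧
  (∀ j ≤ ⌊t⌋₊, MemLp (iterWeakDeriv a b j u) 2 (vol a b)) ∧
  fractionalPartSq a b t u ≠ ⊤

/-- The norm `‖u‖_t` of `H^t(a, b)`, meaningful for `u ∈ H^t(a, b)`: the square root of
`∑_{j ≤ m} ‖u^(j)‖² + [u^(m)]²`, where `m = ⌊t⌋` and the last term, the Slobodeckij seminorm of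
order `t - m`, occurs only when `t` is not an integer. -/
def sobolevNorm (a b t : ℝ) (u : ℝ → ℝ) : ℝ :=
  Real.sqrt (∑ j ∈ Finset.range (⌊t⌋₊ + 1),
      (eLpNorm (iterWeakDeriv a b j u) 2 (vol a b)).toReal ^ 2
    + (fractionalPartSq a b t u).toReal)

/-- The function `g`, given up to null sets of `(a, b)`, has a representative that is continuous on
`[a, b]`, and the value of this representative at `x` is `c`. -/
def HasTrace (a b : ℝ) (g : ℝ → ℝ) (x c : ℝ) : Prop :=
  ∃ w : ℝ → ℝ, ContinuousOn w (Icc a b) ∧ w =ᵐ[vol a b] g ∧ w x = c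

/-! ### The boundary value problem -/

/-- The standing assumptions on the coefficients, apart from the regularity of `a₂`:
`a₂ ≥ a_min > 0`, `a₀ ≥ 0` and `a₀ ∈ L^∞(a, b)`. -/
structure IsCoefficients (a b amin : ℝ) (a₂ a₀ : ℝ → ℝ) : Prop where
  amin_pos : 0 < amin
  le_a₂ : ∀ᵐ x ∂vol a b, amin ≤ a₂ x
  a₀_nonneg : ∀ᵐ x ∂vol a b, 0 ≤ a₀ x
  a₀_bounded : MemLp a₀ ⊤ (vol a b)

/-- `u ∈ H²(a, b)` (`u` itself being the continuous representative on `[a, b]`) solves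
`-(a₂ u')' + a₀ u = f` on `(a, b)`, `u(a) = 0`, `u'(b) = 0`.
The equation says that the weak derivative of `a₂ u'` is `a₀ u - f`. -/
structure IsExactSolution (a b : ℝ) (a₂ a₀ f u : ℝ → ℝ) : Prop where
  memSobolev : MemSobolev a b 2 u
  continuousOn : ContinuousOn u (Icc a b)
  left : u a = 0
  right : HasTrace a b (weakDeriv a b u) b 0
  equation : HasWeakDeriv a b (fun x => a₂ x * weakDeriv a b u x) (fun x => a₀ x * u x - f x)

/-! ### Partitions, weak functions and the discrete weak derivative -/

/-- A partition `a = x_0 < x_1 < ⋯ < x_n = b`, with elements `I_i = (x_i, x_{i+1})`, `i < n`. -/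
structure Partition (a b : ℝ) where
  n : ℕ
  node : Fin (n + 1) → ℝ
  strictMono : StrictMono node
  node_zero : node 0 = a
  node_last : node (Fin.last n) = b

/-- The mesh size `h = max_i (x_{i+1} - x_i)`. -/
def Partition.meshSize {a b : ℝ} (M : Partition a b) : ℝ :=
  ⨆ i : Fin M.n, (M.node i.succ - M.node i.castSucc)

/-- A discrete weak function that is single valued at the nodes of a partition with `n` elements:
a polynomial `v⁰` in the interior of each element and, independently of these, one value per node.
On the element `I_i` it is the weak function
`{v⁰, v^i, v^{i+1}} = {interior i, nodal i.castSucc, nodal i.succ}`. -/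
structure WeakFunction (n : ℕ) where
  interior : Fin n → ℝ[X]
  nodal : Fin (n + 1) → ℝ

/-- Membership in the weak finite element space `S_h`: the interior polynomials have degree at most
`k`, and the value at the left endpoint of the interval vanishes. -/
def WeakFunction.MemSh {n : ℕ} (k : ℕ) (v : WeakFunction n) : Prop :=
  (∀ i, (v.interior i).natDegree ≤ k) ∧ v.nodal 0 = 0

/-- `p ∈ P_r` is the discrete weak derivative on `(y, z)` of the weak function `{v⁰, v^y, v^z}`:
`∫ p q = - ∫ v⁰ q' + v^z q(z) - v^y q(y)` for all `q ∈ P_r`. -/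
def IsDiscreteWeakDeriv (r : ℕ) (y z : ℝ) (v₀ : ℝ[X]) (vy vz : ℝ) (p : ℝ[X]) : Prop :=
  p.natDegree ≤ r ∧ ∀ q : ℝ[X], q.natDegree ≤ r →
    ∫ x in y..z, p.eval x * q.eval x =
      - (∫ x in y..z, v₀.eval x * (derivative q).eval x) + vz * q.eval z - vy * q.eval y

open Classical in
/-- The discrete weak derivative; for `y < z` it exists and is unique
(`existsUnique_discreteWeakDeriv`). -/
def discreteWeakDeriv (r : ℕ) (y z : ℝ) (v₀ : ℝ[X]) (vy vz : ℝ) : ℝ[X] :=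
  if h : ∃ p, IsDiscreteWeakDeriv r y z v₀ vy vz p then h.choose else 0

lemma intervalIntegrable_eval (y z : ℝ) (p : ℝ[X]) :
    IntervalIntegrable (fun x => p.eval x) volume y z :=
  p.continuous.intervalIntegrable y z

lemma eq_zero_of_integral_sq {y z : ℝ} (h : y < z) (p : ℝ[X])
    (hp : ∫ x in y..z, p.eval x * p.eval x = 0) : p = 0 := by
  by_contra hne
  have hex : ∃ c ∈ Icc y z, p.eval c ≠ 0 := by
    by_contra! hall
    exact hne (Polynomial.eq_zero_of_infinite_isRoot p
      ((Icc_infinite h).mono fun x hx => hall x hx))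
  obtain ⟨c, hc, hpc⟩ := hex
  have := intervalIntegral.integral_pos (f := fun x => p.eval x * p.eval x) h
    (by fun_prop) (fun x _ => mul_self_nonneg _)
    ⟨c, hc, mul_self_pos.2 hpc⟩
  exact this.ne' hp

/-- The `L²` inner product on polynomials, restricted to `P_r`. -/
def polyInner (r : ℕ) (y z : ℝ) :
    degreeLT ℝ (r + 1) →ₗ[ℝ] degreeLT ℝ (r + 1) →ₗ[ℝ] ℝ :=
  LinearMap.mk₂ ℝ (fun p q => ∫ x in y..z, (p : ℝ[X]).eval x * (q : ℝ[X]).eval x)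
    (by
      intro p p' q
      simp only [Submodule.coe_add, eval_add, add_mul]
      exact intervalIntegral.integral_add
        (Continuous.intervalIntegrable (by fun_prop) _ _)
        (Continuous.intervalIntegrable (by fun_prop) _ _))
    (by
      intro c p q
      simp only [Submodule.coe_smul, eval_smul, smul_eq_mul, mul_assoc]
      exact intervalIntegral.integral_const_mul _ _)
    (by
      intro p q q'
      simp only [Submodule.coe_add, eval_add, mul_add]
      exact intervalIntegral.integral_add
        (Continuous.intervalIntegrable (by fun_prop) _ _)
        (Continuous.intervalIntegrable (by fun_prop) _ _))
    (by
      intro c p q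
      simp only [Submodule.coe_smul, eval_smul, smul_eq_mul, mul_left_comm _ c]
      exact intervalIntegral.integral_const_mul _ _)

/-- The right-hand side of the equation that defines the discrete weak derivative. -/
def weakDerivFunctional (r : ℕ) (y z : ℝ) (v₀ : ℝ[X]) (vy vz : ℝ) :
    degreeLT ℝ (r + 1) →ₗ[ℝ] ℝ where
  toFun q := - (∫ x in y..z, v₀.eval x * (derivative (q : ℝ[X])).eval x)
    + vz * (q : ℝ[X]).eval z - vy * (q : ℝ[X]).eval y
  map_add' q q' := by
    simp only [Submodule.coe_add, derivative_add, eval_add, mul_add]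
    rw [intervalIntegral.integral_add
        (Continuous.intervalIntegrable (by fun_prop) _ _)
        (Continuous.intervalIntegrable (by fun_prop) _ _)]
    ring
  map_smul' c q := by
    simp only [Submodule.coe_smul, derivative_smul, eval_smul, smul_eq_mul, mul_left_comm _ c,
      RingHom.id_apply, intervalIntegral.integral_const_mul]
    ring

lemma mem_degreeLT_iff (r : ℕ) (p : ℝ[X]) : p ∈ degreeLT ℝ (r + 1) ↔ p.natDegree ≤ r := by
  rw [mem_degreeLT, ← Nat.lt_succ_iff]
  rcases eq_or_ne p 0 with rfl | hp
  · simp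
  · rw [← natDegree_lt_iff_degree_lt hp]

lemma existsUnique_discreteWeakDeriv (r : ℕ) {y z : ℝ} (h : y < z) (v₀ : ℝ[X]) (vy vz : ℝ) :
    ∃! p, IsDiscreteWeakDeriv r y z v₀ vy vz p := by
  have hinj : Function.Injective (polyInner r y z) := by
    rw [← LinearMap.ker_eq_bot, LinearMap.ker_eq_bot']
    intro p hp
    have h1 : polyInner r y z p p = 0 := by rw [hp]; rfl
    exact Subtype.ext (eq_zero_of_integral_sq h p h1)
  have : FiniteDimensional ℝ (degreeLT ℝ (r + 1)) :=
    Module.Finite.equiv (degreeLTEquiv ℝ (r + 1)).symm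
  have hsurj : Function.Surjective (polyInner r y z) :=
    (LinearMap.injective_iff_surjective_of_finrank_eq_finrank
      (Subspace.dual_finrank_eq (K := ℝ)).symm).1 hinj
  obtain ⟨p, hp⟩ := hsurj (weakDerivFunctional r y z v₀ vy vz)
  refine ⟨p, ⟨(mem_degreeLT_iff r _).1 p.2, fun q hq => ?_⟩, fun p' hp' => ?_⟩
  · exact LinearMap.congr_fun hp ⟨q, (mem_degreeLT_iff r q).2 hq⟩
  · have : polyInner r y z ⟨p', (mem_degreeLT_iff r p').2 hp'.1⟩ = polyInner r y z p := by
      rw [hp]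
      ext q
      exact hp'.2 q ((mem_degreeLT_iff r _).1 q.2)
    exact congrArg Subtype.val (hinj this)

lemma discreteWeakDeriv_spec (r : ℕ) {y z : ℝ} (h : y < z) (v₀ : ℝ[X]) (vy vz : ℝ) :
    IsDiscreteWeakDeriv r y z v₀ vy vz (discreteWeakDeriv r y z v₀ vy vz) := by
  have hex := (existsUnique_discreteWeakDeriv r h v₀ vy vz).exists
  rw [discreteWeakDeriv, dif_pos hex]
  exact hex.choose_spec

/-- `d_{w,r} v` on the element `I_i`. -/
def WeakFunction.dw {a b : ℝ} (M : Partition a b) (r : ℕ) (v : WeakFunction M.n) (i : Fin M.n) :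
    ℝ[X] :=
  discreteWeakDeriv r (M.node i.castSucc) (M.node i.succ) (v.interior i)
    (v.nodal i.castSucc) (v.nodal i.succ)

/-- `u_h ∈ S_h` solves the scheme
`(a₂ d_{w,r} u_h, d_{w,r} v)_h + (a₀ u_h⁰, v⁰) = (f, v⁰)` for all `v ∈ S_h`. -/
def IsDiscreteSolution {a b : ℝ} (M : Partition a b) (k r : ℕ) (a₂ a₀ f : ℝ → ℝ)
    (uh : WeakFunction M.n) : Prop :=
  uh.MemSh k ∧ ∀ v : WeakFunction M.n, v.MemSh k →
    ∑ i, (∫ x in (M.node i.castSucc)..(M.node i.succ),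
        a₂ x * (uh.dw M r i).eval x * (v.dw M r i).eval x)
      + ∑ i, (∫ x in (M.node i.castSucc)..(M.node i.succ),
        a₀ x * (uh.interior i).eval x * (v.interior i).eval x)
    = ∑ i, (∫ x in (M.node i.castSucc)..(M.node i.succ), f x * (v.interior i).eval x)

/-- The derivative error `‖d_{w,r} u_h - u'‖_h`. -/
def derivError {a b : ℝ} (M : Partition a b) (r : ℕ) (u : ℝ → ℝ) (uh : WeakFunction M.n) : ℝ :=
  Real.sqrt (∑ i, ∫ x in (M.node i.castSucc)..(M.node i.succ),
    ((uh.dw M r i).eval x - weakDeriv a b u x) ^ 2)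

/-- The nodal error `max_i |u_h^i - u(x_i)|`. -/
def nodalError {a b : ℝ} (M : Partition a b) (u : ℝ → ℝ) (uh : WeakFunction M.n) : ℝ :=
  ⨆ i : Fin (M.n + 1), |uh.nodal i - u (M.node i)|

end WeakFE

end

namespace WeakFE

/-! ### Square integrable functions on intervals -/

/-! On each element let `π` and `w` be the $L^2$ projections of $u$ onto $P_k$ and of $u'$ onto
$P_{k+1}$. Integration by parts shows that the weak function with interior part `π` and nodal values
$u(x_i)$ has discrete weak derivative `w` (`isDiscreteWeakDeriv_projection`). Subtracting it from
$u_h$ leaves a discrete error `e` in $S_h$, whose discrete weak derivative is called `d`; everything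
reduces to bounding `d`.

The flux $p=a_2u'$ satisfies $p'=a_0u-f$ and $p(b)=0$. Replace it on each element by the polynomial
`ρ` of degree at most $k+1$ that starts at the value of $p$ and whose derivative is the projection
of $p'$ onto $P_k$; its final value then also agrees with $p$. Testing the definition of `d` with
`ρ` turns $(f,e^0)$ into flux terms, and the nodal terms telescope to zero because $e(a)=0=p(b)$.
What remains (`error_identity`) is
$(a_2d,d)+(a_0e^0,e^0)=(\rho-p,d)+(a_2(u'-w),d)+(a_0(u-\pi),e^0)$. A discrete Poincaré inequality
(`IsDiscreteWeakDeriv.bounds`, `abs_nodal_add_le`) controls $e^0$ and the nodal values by `d`, so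
coercivity bounds `d` by three approximation errors (`IsDiscreteSolution.error_le`).

Only approximation in $P_k$ of $p'$ to order $s$ is needed, since integrating it to `ρ` gains a
power of $h$; $u'$ is approximated in $P_{k+1}$ and $u$ in $P_k$, both to order $s+1$. The last
requirement limits $s$ to $k$. It disappears when $a_0=0$, which gives the extra order in the second
part.

The approximation results rest on one step: integrating a polynomial approximation of $g'$ gives one
of $g$, with one more degree and one more order (`ApproxBy.of_hasPrim`). It starts from the zero
polynomial, or from a constant supplied by the Slobodeckij seminorm. Products, needed for
$(a_2u')'$, follow by induction through the product rule (`exists_approxBy_mul`). -/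

lemma memLp_sub {a b y z p} {g : ℝ → ℝ} (hg : MemLp g p (vol a b)) (hy : a ≤ y) (hz : z ≤ b) :
    MemLp g p (vol y z) :=
  hg.mono_measure (Measure.restrict_mono (Ioo_subset_Ioo hy hz) le_rfl)

lemma intervalIntegrable_of_integrable {y z : ℝ} (hyz : y ≤ z) {g : ℝ → ℝ}
    (hg : Integrable g (vol y z)) : IntervalIntegrable g volume y z :=
  (intervalIntegrable_iff_integrableOn_Ioo_of_le hyz).2 hg

lemma intervalIntegrable_mul {y z : ℝ} (hyz : y ≤ z) {f g : ℝ → ℝ}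
    (hf : MemLp f 2 (vol y z)) (hg : MemLp g 2 (vol y z)) :
    IntervalIntegrable (fun x => f x * g x) volume y z :=
  intervalIntegrable_of_integrable hyz (hf.integrable_mul hg)

lemma intervalIntegrable_sq {y z : ℝ} (hyz : y ≤ z) {f : ℝ → ℝ}
    (hf : MemLp f 2 (vol y z)) : IntervalIntegrable (fun x => f x ^ 2) volume y z := by
  simpa only [sq] using intervalIntegrable_mul hyz hf hf

lemma memLp_top_of_continuousOn {y z : ℝ} {g : ℝ → ℝ} (hg : ContinuousOn g (Icc y z)) :
    MemLp g ⊤ (vol y z) := by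
  obtain ⟨C, hC⟩ := isCompact_Icc.exists_bound_of_continuousOn hg
  refine memLp_top_of_bound ((hg.mono Ioo_subset_Icc_self).aestronglyMeasurable
    measurableSet_Ioo) C ?_
  filter_upwards [ae_restrict_mem measurableSet_Ioo] with x hx
  exact hC x (Ioo_subset_Icc_self hx)

lemma memLp_of_continuousOn {y z : ℝ} {g : ℝ → ℝ} (hg : ContinuousOn g (Icc y z)) :
    MemLp g 2 (vol y z) :=
  (memLp_top_of_continuousOn hg).mono_exponent le_top

lemma memLp_eval (y z : ℝ) (p : ℝ[X]) : MemLp (fun x => p.eval x) 2 (vol y z) :=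
  memLp_of_continuousOn p.continuous.continuousOn

lemma memLp_bounded_mul {y z : ℝ} {f g : ℝ → ℝ} (hf : MemLp f ⊤ (vol y z))
    (hg : MemLp g 2 (vol y z)) : MemLp (fun x => f x * g x) 2 (vol y z) :=
  hg.mul hf

lemma memLp_mul_bounded {y z : ℝ} {f g : ℝ → ℝ} (hf : MemLp f 2 (vol y z))
    (hg : MemLp g ⊤ (vol y z)) : MemLp (fun x => f x * g x) 2 (vol y z) :=
  hg.mul hf

lemma integral_congr_vol {y z : ℝ} (hyz : y ≤ z) {f g : ℝ → ℝ} (h : f =ᵐ[vol y z] g) :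
    ∫ x in y..z, f x = ∫ x in y..z, g x := by
  rw [intervalIntegral.integral_of_le hyz, intervalIntegral.integral_of_le hyz,
    integral_Ioc_eq_integral_Ioo, integral_Ioc_eq_integral_Ioo]
  exact integral_congr_ae h

lemma integral_mono_vol {y z : ℝ} (hyz : y ≤ z) {f g : ℝ → ℝ}
    (hf : IntervalIntegrable f volume y z) (hg : IntervalIntegrable g volume y z)
    (h : f ≤ᵐ[vol y z] g) :
    ∫ x in y..z, f x ≤ ∫ x in y..z, g x := by
  rw [intervalIntegral.integral_of_le hyz, intervalIntegral.integral_of_le hyz,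
    integral_Ioc_eq_integral_Ioo, integral_Ioc_eq_integral_Ioo]
  exact integral_mono_ae ((intervalIntegrable_iff_integrableOn_Ioo_of_le hyz).1 hf)
    ((intervalIntegrable_iff_integrableOn_Ioo_of_le hyz).1 hg) h

lemma ae_vol_sub {a b y z : ℝ} (hy : a ≤ y) (hz : z ≤ b) {P : ℝ → Prop}
    (h : ∀ᵐ x ∂vol a b, P x) : ∀ᵐ x ∂vol y z, P x :=
  ae_restrict_of_ae_restrict_of_subset (Ioo_subset_Ioo hy hz) h

lemma integral_sq_nonneg {y z : ℝ} (hyz : y ≤ z) (f : ℝ → ℝ) : 0 ≤ ∫ x in y..z, f x ^ 2 :=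
  intervalIntegral.integral_nonneg hyz fun _ _ => sq_nonneg _

/-- The Cauchy-Schwarz inequality. -/
lemma integral_mul_sq_le {y z : ℝ} (hyz : y ≤ z) {f g : ℝ → ℝ}
    (hf : MemLp f 2 (vol y z)) (hg : MemLp g 2 (vol y z)) :
    (∫ x in y..z, f x * g x) ^ 2 ≤ (∫ x in y..z, f x ^ 2) * ∫ x in y..z, g x ^ 2 := by
  have key : ∀ t : ℝ, 0 ≤ (∫ x in y..z, f x ^ 2) * (t * t)
      + (-2 * ∫ x in y..z, f x * g x) * t + ∫ x in y..z, g x ^ 2 := by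
    intro t
    have h0 : 0 ≤ ∫ x in y..z, (t * f x - g x) ^ 2 := integral_sq_nonneg hyz _
    have h1 : ∫ x in y..z, (t * f x - g x) ^ 2
        = ∫ x in y..z, ((t * t) * f x ^ 2 - (2 * t) * (f x * g x)) + g x ^ 2 :=
      intervalIntegral.integral_congr fun x _ => by ring
    rw [h1, intervalIntegral.integral_add
        (((intervalIntegrable_sq hyz hf).const_mul _).sub
          ((intervalIntegrable_mul hyz hf hg).const_mul _)) (intervalIntegrable_sq hyz hg),
      intervalIntegral.integral_sub ((intervalIntegrable_sq hyz hf).const_mul _)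
          ((intervalIntegrable_mul hyz hf hg).const_mul _),
      intervalIntegral.integral_const_mul, intervalIntegral.integral_const_mul] at h0
    linarith
  have := discrim_le_zero key
  rw [discrim] at this
  nlinarith

lemma abs_integral_mul_le {y z : ℝ} (hyz : y ≤ z) {f g : ℝ → ℝ}
    (hf : MemLp f 2 (vol y z)) (hg : MemLp g 2 (vol y z)) :
    |∫ x in y..z, f x * g x| ≤ √(∫ x in y..z, f x ^ 2) * √(∫ x in y..z, g x ^ 2) := by
  rw [← Real.sqrt_mul (integral_sq_nonneg hyz f)]
  exact Real.abs_le_sqrt (integral_mul_sq_le hyz hf hg)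

lemma integral_sq_le_length {y z : ℝ} (hyz : y ≤ z) {g : ℝ → ℝ} (hg : MemLp g 2 (vol y z)) :
    (∫ x in y..z, g x) ^ 2 ≤ (z - y) * ∫ x in y..z, g x ^ 2 := by
  have h := integral_mul_sq_le hyz (f := fun _ => 1) (memLp_of_continuousOn continuousOn_const) hg
  simpa using h

lemma memLp_congr {y z : ℝ} {f g : ℝ → ℝ} (hf : MemLp f 2 (vol y z)) (h : f =ᵐ[vol y z] g) :
    MemLp g 2 (vol y z) := (memLp_congr_ae h).1 hf

/-! ### Primitives of integrable functions -/

/-- `g` is a primitive of the integrable function `g'` on `[a, b]`. -/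
def HasPrim (a b : ℝ) (g g' : ℝ → ℝ) : Prop :=
  IntervalIntegrable g' volume a b ∧ ∀ x ∈ Icc a b, g x = g a + ∫ t in a..x, g' t

lemma HasPrim.intervalIntegrable {a b y z : ℝ} {g g' : ℝ → ℝ} (h : HasPrim a b g g')
    (hy : a ≤ y) (hyz : y ≤ z) (hz : z ≤ b) : IntervalIntegrable g' volume y z :=
  h.1.mono_set (by
    rw [uIcc_of_le hyz, uIcc_of_le (hy.trans (hyz.trans hz))]; exact Icc_subset_Icc hy hz)

lemma HasPrim.integral {a b y z : ℝ} {g g' : ℝ → ℝ} (h : HasPrim a b g g')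
    (hy : a ≤ y) (hyz : y ≤ z) (hz : z ≤ b) : ∫ x in y..z, g' x = g z - g y := by
  rw [h.2 z ⟨by linarith, hz⟩, h.2 y ⟨hy, by linarith⟩,
    ← intervalIntegral.integral_add_adjacent_intervals
      (h.intervalIntegrable le_rfl hy (by linarith)) (h.intervalIntegrable hy hyz hz)]
  ring

lemma HasPrim.sub_interval {a b y z : ℝ} {g g' : ℝ → ℝ} (h : HasPrim a b g g')
    (hy : a ≤ y) (hyz : y ≤ z) (hz : z ≤ b) : HasPrim y z g g' :=
  ⟨h.intervalIntegrable hy hyz hz, fun x hx => by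
    rw [h.integral hy hx.1 (by linarith [hx.2])]; ring⟩

lemma HasPrim.continuousOn {a b : ℝ} {g g' : ℝ → ℝ} (hab : a ≤ b) (h : HasPrim a b g g') :
    ContinuousOn g (Icc a b) := by
  have h1 := intervalIntegral.continuousOn_primitive_interval' h.1 left_mem_uIcc
  rw [uIcc_of_le hab] at h1
  exact (continuousOn_const.add h1).congr fun x hx => h.2 x hx

lemma HasPrim.sub {a b : ℝ} {g g' w w' : ℝ → ℝ} (hg : HasPrim a b g g')
    (hw : HasPrim a b w w') :
    HasPrim a b (fun x => g x - w x) (fun x => g' x - w' x) := by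
  refine ⟨hg.1.sub hw.1, fun x hx => ?_⟩
  rw [intervalIntegral.integral_sub (hg.intervalIntegrable le_rfl hx.1 hx.2)
    (hw.intervalIntegrable le_rfl hx.1 hx.2)]
  linarith [hg.2 x hx, hw.2 x hx]

lemma HasPrim.congr_right {a b : ℝ} {g g' w : ℝ → ℝ} (hab : a ≤ b) (hg : HasPrim a b g g')
    (hw : g' =ᵐ[vol a b] w) : HasPrim a b g w := by
  refine ⟨intervalIntegrable_of_integrable hab
    (((intervalIntegrable_iff_integrableOn_Ioo_of_le hab).1 hg.1).congr hw), fun x hx => ?_⟩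
  rw [hg.2 x hx, integral_congr_vol hx.1 (ae_vol_sub le_rfl hx.2 hw)]

lemma HasPrim.congr_left {a b : ℝ} {g g' w : ℝ → ℝ} (hab : a ≤ b) (hg : HasPrim a b g g')
    (hw : EqOn g w (Icc a b)) : HasPrim a b w g' :=
  ⟨hg.1, fun x hx => by rw [← hw hx, ← hw (left_mem_Icc.2 hab), hg.2 x hx]⟩

lemma hasPrim_of_contDiff {a b : ℝ} {φ : ℝ → ℝ} (h : ContDiff ℝ 1 φ) :
    HasPrim a b φ (deriv φ) := by
  have hc : Continuous (deriv φ) := h.continuous_deriv le_rfl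
  refine ⟨hc.intervalIntegrable _ _, fun x _ => ?_⟩
  rw [intervalIntegral.integral_deriv_eq_sub (fun y _ => h.differentiable one_ne_zero y)
    (hc.intervalIntegrable _ _)]
  ring

lemma hasPrim_eval (a b : ℝ) (p : ℝ[X]) :
    HasPrim a b (fun x => p.eval x) (fun x => (derivative p).eval x) := by
  have h : deriv (fun x => p.eval x) = fun x => (derivative p).eval x := funext fun x => p.deriv
  rw [← h]
  exact hasPrim_of_contDiff (by simpa using p.contDiff_aeval (𝕜 := ℝ) 1)

/-- Absolute continuity and Lebesgue's differentiation theorem apply directly to the integral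
function, which agrees with `g` on $[a,b]$; `HasPrim` leaves `g` free elsewhere. -/
lemma HasPrim.absolutelyContinuous {a b : ℝ} {g g' : ℝ → ℝ} (h : HasPrim a b g g') :
    AbsolutelyContinuousOnInterval (fun x => g a + ∫ t in a..x, g' t) a b ∧
    ∀ᵐ x, x ∈ uIcc a b → HasDerivAt (fun x => g a + ∫ t in a..x, g' t) (g' x) x := by
  constructor
  · have h1 := h.1.absolutelyContinuousOnInterval_intervalIntegral (c := a) left_mem_uIcc
    have h2 : AbsolutelyContinuousOnInterval (fun _ : ℝ => g a) a b :=
      (contDiff_const (n := 1)).contDiffOn.absolutelyContinuousOnInterval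
    exact h2.fun_add h1
  · filter_upwards [h.1.ae_hasDerivAt_integral] with x hx hx'
    exact (hx hx' a left_mem_uIcc).const_add _

/-- Two functions with the same primitive coincide almost everywhere. -/
lemma HasPrim.ae_eq {a b : ℝ} {g g' w : ℝ → ℝ} (hab : a ≤ b) (hg : HasPrim a b g g')
    (hw : HasPrim a b g w) : g' =ᵐ[vol a b] w := by
  refine (ae_restrict_iff' measurableSet_Ioo).2 ?_
  -- Near an interior point both integral functions coincide with `g`, so their derivatives, almost
  -- everywhere `g'` and `w`, are equal.
  filter_upwards [(hg.absolutelyContinuous).2, (hw.absolutelyContinuous).2] with x h1 h2 hx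
  have hx' : x ∈ uIcc a b := by rw [uIcc_of_le hab]; exact Ioo_subset_Icc_self hx
  refine (h1 hx').unique ((h2 hx').congr_of_eventuallyEq ?_)
  filter_upwards [isOpen_Ioo.mem_nhds hx] with t ht
  rw [← hg.2 t (Ioo_subset_Icc_self ht), ← hw.2 t (Ioo_subset_Icc_self ht)]

/-- The product rule. -/
lemma HasPrim.mul {a b : ℝ} {g g' w w' : ℝ → ℝ} (hab : a ≤ b) (hg : HasPrim a b g g')
    (hw : HasPrim a b w w') :
    HasPrim a b (fun x => g x * w x) (fun x => g' x * w x + g x * w' x) := by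
  have cg := hg.continuousOn hab
  have cw := hw.continuousOn hab
  rw [← uIcc_of_le hab] at cg cw
  refine ⟨(hg.1.mul_continuousOn cw).add (hw.1.continuousOn_mul cg), fun x hx => ?_⟩
  have hg1 := hg.sub_interval le_rfl hx.1 hx.2
  have hw1 := hw.sub_interval le_rfl hx.1 hx.2
  obtain ⟨Ag, dg⟩ := hg1.absolutelyContinuous
  obtain ⟨Aw, dw⟩ := hw1.absolutelyContinuous
  have key := Ag.integral_deriv_mul_eq_sub Aw
  have hcongr : ∫ t in a..x, g' t * w t + g t * w' t = ∫ t in a..x,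
      deriv (fun x => g a + ∫ t in a..x, g' t) t * (w a + ∫ t in a..t, w' t)
        + (g a + ∫ t in a..t, g' t) * deriv (fun x => w a + ∫ t in a..x, w' t) t := by
    refine intervalIntegral.integral_congr_ae ?_
    filter_upwards [dg, dw] with t h1 h2 ht
    have ht' := uIoc_subset_uIcc ht
    have ht2 : t ∈ Icc a x := by rwa [uIcc_of_le hx.1] at ht'
    rw [(h1 ht').deriv, (h2 ht').deriv, ← hg1.2 t ht2, ← hw1.2 t ht2]
  rw [hcongr, key, ← hg.2 x hx, ← hw.2 x hx]
  simp

lemma HasPrim.integral_by_parts {a b y z : ℝ} {g g' w w' : ℝ → ℝ} (hg : HasPrim a b g g')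
    (hw : HasPrim a b w w') (hy : a ≤ y) (hyz : y ≤ z) (hz : z ≤ b) :
    ∫ x in y..z, g' x * w x = - (∫ x in y..z, g x * w' x) + g z * w z - g y * w y := by
  have hg1 := hg.sub_interval hy hyz hz
  have hw1 := hw.sub_interval hy hyz hz
  have cg := hg1.continuousOn hyz
  have cw := hw1.continuousOn hyz
  rw [← uIcc_of_le hyz] at cg cw
  have h := (hg1.mul hyz hw1).integral le_rfl hyz le_rfl
  rw [intervalIntegral.integral_add (hg1.1.mul_continuousOn cw) (hw1.1.continuousOn_mul cg)] at h
  linarith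

lemma HasPrim.sub_sq_le {a b y z s t : ℝ} {g g' : ℝ → ℝ} (hg : HasPrim a b g g')
    (hL : MemLp g' 2 (vol a b)) (hy : a ≤ y) (hz : z ≤ b) (hs : s ∈ Icc y z) (ht : t ∈ Icc y z) :
    (g t - g s) ^ 2 ≤ (z - y) * ∫ x in y..z, g' x ^ 2 := by
  wlog hst : s ≤ t generalizing s t
  · have := this ht hs (le_of_not_ge hst)
    rwa [← sub_sq_comm]
  have hyz : y ≤ z := hs.1.trans hs.2
  have hL' := memLp_sub hL (y := s) (z := t) (by linarith [hs.1]) (by linarith [ht.2])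
  rw [← hg.integral (by linarith [hs.1]) hst (by linarith [ht.2])]
  refine (integral_sq_le_length hst hL').trans ?_
  have h1 : ∫ x in s..t, g' x ^ 2 ≤ ∫ x in y..z, g' x ^ 2 :=
    intervalIntegral.integral_mono_interval hs.1 hst ht.2
      (Filter.Eventually.of_forall fun _ => sq_nonneg _)
      (intervalIntegrable_sq hyz (memLp_sub hL hy hz))
  exact mul_le_mul (by linarith [hs.1, ht.2]) h1 (integral_sq_nonneg hst _) (by linarith)

/-! ### Weak derivatives and primitives -/

lemma exists_Icc_of_isCompact {a b : ℝ} (hab : a < b) {K : Set ℝ} (hK : IsCompact K)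
    (hKab : K ⊆ Ioo a b) : ∃ c d, a < c ∧ d < b ∧ c ≤ d ∧ K ⊆ Icc c d := by
  rcases K.eq_empty_or_nonempty with rfl | hne
  · exact ⟨(a + b) / 2, (a + b) / 2, by linarith, by linarith, le_rfl, empty_subset _⟩
  obtain ⟨c, hc, hc'⟩ := hK.exists_isLeast hne
  obtain ⟨d, hd, hd'⟩ := hK.exists_isGreatest hne
  exact ⟨c, d, (hKab hc).1, (hKab hd).2, hc' hd, fun x hx => ⟨hc' hx, hd' hx⟩⟩

/-- A test function of mean zero has a primitive that is a test function. -/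
lemma exists_testFunction_primitive {a b : ℝ} (hab : a < b) {ψ : ℝ → ℝ} (h1 : ContDiff ℝ ∞ ψ)
    (h2 : HasCompactSupport ψ) (h3 : tsupport ψ ⊆ Ioo a b) (h4 : ∫ x in Ioo a b, ψ x = 0) :
    ∃ Φ : ℝ → ℝ, ContDiff ℝ ∞ Φ ∧ HasCompactSupport Φ ∧ tsupport Φ ⊆ Ioo a b ∧ deriv Φ = ψ := by
  obtain ⟨c, d, hac, hdb, hcd, hK⟩ := exists_Icc_of_isCompact hab h2 h3
  have hz : ∀ x, x ∉ Icc c d → ψ x = 0 := fun x hx => image_eq_zero_of_notMem_tsupport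
    fun h => hx (hK h)
  have hi : ∀ x y, IntervalIntegrable ψ volume x y := fun x y =>
    h1.continuous.intervalIntegrable x y
  have hd : ∀ x, HasDerivAt (fun x => ∫ t in a..x, ψ t) (ψ x) x := fun x =>
    intervalIntegral.integral_hasDerivAt_right (hi a x)
      h1.continuous.aestronglyMeasurable.stronglyMeasurableAtFilter h1.continuous.continuousAt
  have hderiv : deriv (fun x => ∫ t in a..x, ψ t) = ψ := funext fun x => (hd x).deriv
  have hsupp : Function.support (fun x => ∫ t in a..x, ψ t) ⊆ Icc c d := by
    intro x hx
    by_contra hxcd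
    apply hx
    have hab0 : ∫ t in a..b, ψ t = 0 := by
      rw [intervalIntegral.integral_of_le hab.le, integral_Ioc_eq_integral_Ioo, h4]
    rcases lt_or_ge x c with hxc | hxc
    · refine (intervalIntegral.integral_congr (g := fun _ => (0 : ℝ)) fun t ht => hz t ?_).trans
        (by simp)
      rintro ⟨ht1, -⟩
      have : t ≤ max a x := ht.2
      have := max_lt hac hxc
      linarith
    · have hxd : d < x := by
        by_contra h
        exact hxcd ⟨hxc, not_lt.1 h⟩
      -- Right of the support the primitive is the total integral, which is zero, minus a vanishing
      -- tail; this is where mean zero enters.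
      have h5 : ∫ t in x..b, ψ t = 0 := by
        refine (intervalIntegral.integral_congr (g := fun _ => (0 : ℝ)) fun t ht => hz t ?_).trans
          (by simp)
        rintro ⟨-, ht1⟩
        have : min x b ≤ t := ht.1
        have := lt_min hxd hdb
        linarith
      have h6 := intervalIntegral.integral_add_adjacent_intervals (hi a x) (hi x b)
      rw [hab0, h5, add_zero] at h6
      exact h6
  have hts : tsupport (fun x => ∫ t in a..x, ψ t) ⊆ Icc c d :=
    closure_minimal hsupp isClosed_Icc
  refine ⟨_, ?_, HasCompactSupport.of_support_subset_isCompact isCompact_Icc hsupp,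
    hts.trans (Icc_subset_Ioo hac hdb), hderiv⟩
  rw [contDiff_infty_iff_deriv]
  exact ⟨fun x => (hd x).differentiableAt, by rwa [hderiv]⟩

lemma exists_testFunction_integral_one {a b : ℝ} (hab : a < b) :
    ∃ φ : ℝ → ℝ, ContDiff ℝ ∞ φ ∧ HasCompactSupport φ ∧ tsupport φ ⊆ Ioo a b ∧
      ∫ x in Ioo a b, φ x = 1 := by
  let B : ContDiffBump ((a + b) / 2) := ⟨(b - a) / 8, (b - a) / 4, by linarith, by linarith⟩
  have hts : tsupport (B.normed volume) ⊆ Ioo a b := by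
    rw [B.tsupport_normed_eq, Real.closedBall_eq_Icc]
    refine Icc_subset_Ioo ?_ ?_ <;> simp only [B] <;> linarith
  refine ⟨B.normed volume, B.contDiff_normed, B.hasCompactSupport_normed, hts, ?_⟩
  rw [setIntegral_eq_integral_of_forall_compl_eq_zero, B.integral_normed]
  exact fun x hx => image_eq_zero_of_notMem_tsupport fun h => hx (hts h)

lemma integrable_mul_testFunction {a b : ℝ} {w φ : ℝ → ℝ} (hw : Integrable w (vol a b))
    (hφ : Continuous φ) : Integrable (fun x => w x * φ x) (vol a b) := by
  obtain ⟨C, hC⟩ := isCompact_Icc.exists_bound_of_continuousOn (hφ.continuousOn (s := Icc a b))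
  refine hw.mul_bdd (c := C) hφ.aestronglyMeasurable ?_
  filter_upwards [ae_restrict_mem measurableSet_Ioo] with x hx
  exact hC x (Ioo_subset_Icc_self hx)

/-- The lemma of du Bois-Reymond. -/
lemma exists_ae_eq_const {a b : ℝ} (hab : a < b) {w : ℝ → ℝ} (hw : Integrable w (vol a b))
    (h : ∀ φ : ℝ → ℝ, ContDiff ℝ ∞ φ → HasCompactSupport φ → tsupport φ ⊆ Ioo a b →
      ∫ x in Ioo a b, w x * deriv φ x = 0) : ∃ c : ℝ, w =ᵐ[vol a b] fun _ => c := by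
  obtain ⟨φ₀, h1, h2, h3, h4⟩ := exists_testFunction_integral_one hab
  set c := ∫ x in Ioo a b, w x * φ₀ x with hc
  refine ⟨c, ?_⟩
  have hwc : Integrable (fun x => w x - c) (vol a b) := hw.sub (integrable_const c)
  have key : ∀ᵐ x, x ∈ Ioo a b → w x - c = 0 := by
    refine isOpen_Ioo.ae_eq_zero_of_integral_contDiff_smul_eq_zero
      (IntegrableOn.locallyIntegrableOn hwc) fun φ k1 k2 k3 => ?_
    rw [← setIntegral_eq_integral_of_forall_compl_eq_zero (s := Ioo a b) (fun x hx => by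
      rw [image_eq_zero_of_notMem_tsupport fun h => hx (k3 h), zero_smul])]
    set m := ∫ x in Ioo a b, φ x with hm
    have hiφ : Integrable φ (vol a b) := (k1.continuous.integrable_of_hasCompactSupport k2).restrict
    have hiφ₀ : Integrable φ₀ (vol a b) :=
      (h1.continuous.integrable_of_hasCompactSupport h2).restrict
    have hmc : ContDiff ℝ ∞ fun x => m * φ₀ x := contDiff_const.mul h1
    have hms : HasCompactSupport fun x => m * φ₀ x := h2.mul_left
    -- Removing the multiple `m * φ₀` makes the mean zero, so the difference is the derivative of a
    -- test function and is annihilated by `w`; hence $\int w\varphi = mc$.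
    obtain ⟨Φ, f1, f2, f3, f4⟩ := exists_testFunction_primitive hab (ψ := fun x => φ x - m * φ₀ x)
      (k1.sub hmc) (k2.sub hms) ((tsupport_sub _ _).trans (union_subset k3
        ((closure_mono (Function.support_mul_subset_right _ _)).trans h3))) (by
        rw [integral_sub hiφ (hiφ₀.const_mul m), integral_const_mul, h4, ← hm]; ring)
    have h5 := h Φ f1 f2 f3
    rw [f4] at h5
    have i1 := integrable_mul_testFunction hw k1.continuous
    have i2 := integrable_mul_testFunction hw h1.continuous
    have h6 : ∫ x in Ioo a b, w x * (φ x - m * φ₀ x) = (∫ x in Ioo a b, w x * φ x) - m * c := by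
      rw [hc, ← integral_const_mul, ← integral_sub i1 (i2.const_mul m)]
      exact integral_congr_ae (Filter.Eventually.of_forall fun x => by ring)
    have h7 : ∫ x in Ioo a b, φ x • (w x - c) = (∫ x in Ioo a b, w x * φ x) - m * c := by
      rw [hm, ← integral_mul_const, ← integral_sub i1 (hiφ.mul_const c)]
      exact integral_congr_ae (Filter.Eventually.of_forall fun x => by
        simp only [smul_eq_mul]; ring)
    rw [h7, ← h6, h5]
  refine (ae_restrict_iff' measurableSet_Ioo).2 ?_
  filter_upwards [key] with x hx hx'
  linarith [hx hx']

lemma HasPrim.integral_mul_deriv {a b : ℝ} (hab : a < b) {g g' φ : ℝ → ℝ} (hg : HasPrim a b g g')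
    (h1 : ContDiff ℝ ∞ φ) (h3 : tsupport φ ⊆ Ioo a b) :
    ∫ x in Ioo a b, g x * deriv φ x = - ∫ x in Ioo a b, g' x * φ x := by
  have h := hg.integral_by_parts (hasPrim_of_contDiff (a := a) (b := b) (h1.of_le (by simp)))
    le_rfl hab.le le_rfl
  have ha : φ a = 0 := image_eq_zero_of_notMem_tsupport fun h => (h3 h).1.false
  have hb : φ b = 0 := image_eq_zero_of_notMem_tsupport fun h => (h3 h).2.false
  rw [ha, hb, intervalIntegral.integral_of_le hab.le, intervalIntegral.integral_of_le hab.le,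
    integral_Ioc_eq_integral_Ioo, integral_Ioc_eq_integral_Ioo] at h
  linarith

/-- An integrable function with integrable weak derivative has an absolutely continuous
representative. -/
lemma HasWeakDeriv.exists_hasPrim {a b : ℝ} (hab : a < b) {u v : ℝ → ℝ}
    (h : HasWeakDeriv a b u v) (hu : Integrable u (vol a b)) (hv : Integrable v (vol a b)) :
    ∃ U, HasPrim a b U v ∧ U =ᵐ[vol a b] u := by
  have hi := intervalIntegrable_of_integrable hab.le hv
  have hV : HasPrim a b (fun x => ∫ t in a..x, v t) v := ⟨hi, fun x _ => by simp⟩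
  have hVi : Integrable (fun x => ∫ t in a..x, v t) (vol a b) :=
    (memLp_of_continuousOn (hV.continuousOn hab.le)).integrable one_le_two
  -- The difference of `u` and the integral of `v` has weak derivative zero, hence is constant.
  obtain ⟨c, hc⟩ := exists_ae_eq_const hab (hu.sub hVi) (fun φ h1 h2 h3 => by
    have hφ' : Continuous (deriv φ) := h1.continuous_deriv (by simp)
    have e1 := integrable_mul_testFunction hu hφ'
    have e2 := integrable_mul_testFunction hVi hφ'
    have e3 := h.2.2 φ h1 h2 h3
    have e4 := hV.integral_mul_deriv hab h1 h3
    simp only [Pi.sub_apply, sub_mul]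
    rw [integral_sub e1 e2, e3, e4, sub_self])
  refine ⟨fun x => c + ∫ t in a..x, v t, ⟨hi, fun x _ => by simp⟩, ?_⟩
  filter_upwards [hc] with x hx
  simp only [Pi.sub_apply] at hx
  linarith

lemma eqOn_of_ae_eq {a b : ℝ} (hab : a < b) {f g : ℝ → ℝ} (h : f =ᵐ[vol a b] g)
    (hf : ContinuousOn f (Icc a b)) (hg : ContinuousOn g (Icc a b)) : EqOn f g (Icc a b) := by
  refine Measure.eqOn_Icc_of_ae_eq volume hab.ne ?_ hf hg
  rwa [← restrict_Ioo_eq_restrict_Icc]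

lemma hasWeakDeriv_weakDeriv {a b : ℝ} {u : ℝ → ℝ} (h : ∃ v, HasWeakDeriv a b u v) :
    HasWeakDeriv a b u (weakDeriv a b u) := by
  rw [weakDeriv, dif_pos h]
  exact h.choose_spec

/-- A function with `n` weak derivatives in `L²` is represented by a chain of primitives. -/
lemma exists_primitive_chain {a b : ℝ} (hab : a < b) {u : ℝ → ℝ} {n : ℕ}
    (h1 : ∀ j < n, ∃ v, HasWeakDeriv a b (iterWeakDeriv a b j u) v)
    (h2 : ∀ j ≤ n, MemLp (iterWeakDeriv a b j u) 2 (vol a b)) :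
    ∃ U : ℕ → ℝ → ℝ, (∀ j < n, HasPrim a b (U j) (U (j + 1))) ∧
      (∀ j, U j =ᵐ[vol a b] iterWeakDeriv a b j u) ∧ ∀ j ≤ n, MemLp (U j) 2 (vol a b) := by
  have hex : ∀ j, ∃ V, V =ᵐ[vol a b] iterWeakDeriv a b j u ∧
      (j < n → HasPrim a b V (iterWeakDeriv a b (j + 1) u)) := by
    intro j
    by_cases hj : j < n
    · have hw : HasWeakDeriv a b (iterWeakDeriv a b j u) (iterWeakDeriv a b (j + 1) u) := by
        have := hasWeakDeriv_weakDeriv (h1 j hj)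
        rwa [iterWeakDeriv, ← Function.iterate_succ_apply' (weakDeriv a b) j u] at this
      obtain ⟨V, hV, hV'⟩ := hw.exists_hasPrim hab ((h2 j hj.le).integrable one_le_two)
        ((h2 (j + 1) hj).integrable one_le_two)
      exact ⟨V, hV', fun _ => hV⟩
    -- From order `n` on no continuous representative is claimed, and the iterated weak derivative
    -- itself is used.
    · exact ⟨_, Filter.EventuallyEq.rfl, fun h => absurd h hj⟩
  choose U hU hU' using hex
  exact ⟨U, fun j hj => (hU' j hj).congr_right hab.le (hU (j + 1)).symm, hU,
    fun j hj => memLp_congr (h2 j hj) (hU j).symm⟩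

/-! ### Local approximation by polynomials -/

/-- A nonnegative superadditive function of the subintervals of `[a, b]`. -/
structure IsEnergy (a b : ℝ) (η : ℝ → ℝ → ℝ) : Prop where
  nonneg : ∀ y z, a ≤ y → y ≤ z → z ≤ b → 0 ≤ η y z
  add_le : ∀ y z w, a ≤ y → y ≤ z → z ≤ w → w ≤ b → η y z + η z w ≤ η y w

lemma IsEnergy.le_total {a b y z : ℝ} {η : ℝ → ℝ → ℝ} (h : IsEnergy a b η) (hy : a ≤ y)
    (hyz : y ≤ z) (hz : z ≤ b) : η y z ≤ η a b := by
  have h1 := h.add_le a y b le_rfl hy (hyz.trans hz) le_rfl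
  have h2 := h.add_le y z b hy hyz hz le_rfl
  have h3 := h.nonneg a y le_rfl hy (hyz.trans hz)
  have h4 := h.nonneg z b (hy.trans hyz) hz le_rfl
  linarith

lemma IsEnergy.add {a b : ℝ} {η θ : ℝ → ℝ → ℝ} (h : IsEnergy a b η) (h' : IsEnergy a b θ) :
    IsEnergy a b fun y z => η y z + θ y z :=
  ⟨fun y z h1 h2 h3 => add_nonneg (h.nonneg y z h1 h2 h3) (h'.nonneg y z h1 h2 h3),
    fun y z w h1 h2 h3 h4 => by
      linarith [h.add_le y z w h1 h2 h3 h4, h'.add_le y z w h1 h2 h3 h4]⟩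

lemma IsEnergy.const_mul {a b c : ℝ} {η : ℝ → ℝ → ℝ} (hc : 0 ≤ c) (h : IsEnergy a b η) :
    IsEnergy a b fun y z => c * η y z :=
  ⟨fun y z h1 h2 h3 => mul_nonneg hc (h.nonneg y z h1 h2 h3),
    fun y z w h1 h2 h3 h4 => by
      rw [← mul_add]; exact mul_le_mul_of_nonneg_left (h.add_le y z w h1 h2 h3 h4) hc⟩

lemma isEnergy_integral_sq {a b : ℝ} {g : ℝ → ℝ} (hg : MemLp g 2 (vol a b)) :
    IsEnergy a b fun y z => ∫ x in y..z, g x ^ 2 :=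
  ⟨fun _ _ _ h2 _ => integral_sq_nonneg h2 _, fun _ _ _ h1 h2 h3 h4 =>
    (intervalIntegral.integral_add_adjacent_intervals
      (intervalIntegrable_sq h2 (memLp_sub hg h1 (h3.trans h4)))
      (intervalIntegrable_sq h3 (memLp_sub hg (h1.trans h2) h4))).le⟩

/-- On every subinterval of `[a, b]` of length `ℓ`, the function `g` is approximated in `L²` by a
polynomial of degree less than `d` up to an error `O(ℓ ^ τ)`, the squares of the constants having
sum at most `K` over every partition of `[a, b]`. -/
def ApproxBy (a b : ℝ) (d : ℕ) (τ K : ℝ) (g : ℝ → ℝ) : Prop :=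
  ∃ η, IsEnergy a b η ∧ η a b ≤ K ∧ ∀ y z, a ≤ y → y < z → z ≤ b →
    ∃ q : ℝ[X], q.degree < d ∧ ∫ x in y..z, (g x - q.eval x) ^ 2 ≤ (z - y) ^ (2 * τ) * η y z

lemma ApproxBy.mono_const {a b τ K K' : ℝ} {d : ℕ} {g : ℝ → ℝ} (h : ApproxBy a b d τ K g)
    (hK : K ≤ K') : ApproxBy a b d τ K' g := by
  obtain ⟨η, h1, h2, h3⟩ := h
  exact ⟨η, h1, h2.trans hK, h3⟩

lemma ApproxBy.mono_exponent {a b τ τ' K : ℝ} {d : ℕ} {g : ℝ → ℝ} (h : ApproxBy a b d τ K g)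
    (hab : a ≤ b) (hτ : τ' ≤ τ) : ApproxBy a b d τ' ((b - a) ^ (2 * (τ - τ')) * K) g := by
  obtain ⟨η, h1, h2, h3⟩ := h
  have hc : 0 ≤ (b - a) ^ (2 * (τ - τ')) := Real.rpow_nonneg (by linarith) _
  refine ⟨_, h1.const_mul hc, mul_le_mul_of_nonneg_left h2 hc, fun y z hy hyz hz => ?_⟩
  obtain ⟨q, hq, hq'⟩ := h3 y z hy hyz hz
  refine ⟨q, hq, hq'.trans ?_⟩
  rw [← mul_assoc]
  refine mul_le_mul_of_nonneg_right ?_ (h1.nonneg y z hy hyz.le hz)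
  rw [show 2 * τ = 2 * τ' + 2 * (τ - τ') by ring, Real.rpow_add (by linarith)]
  exact mul_le_mul_of_nonneg_left (Real.rpow_le_rpow (by linarith) (by linarith) (by linarith))
    (Real.rpow_nonneg (by linarith) _)

lemma ApproxBy.congr {a b τ K : ℝ} {d : ℕ} {g w : ℝ → ℝ} (h : ApproxBy a b d τ K g)
    (hw : g =ᵐ[vol a b] w) : ApproxBy a b d τ K w := by
  obtain ⟨η, h1, h2, h3⟩ := h
  refine ⟨η, h1, h2, fun y z hy hyz hz => ?_⟩
  obtain ⟨q, hq, hq'⟩ := h3 y z hy hyz hz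
  refine ⟨q, hq, le_of_eq_of_le (integral_congr_vol hyz.le ?_) hq'⟩
  filter_upwards [ae_vol_sub hy hz hw] with x hx
  rw [hx]

/-- With `d = 0` only the zero polynomial is admissible. This starts the induction by integration
when the order is an integer. -/
lemma approxBy_zero {a b : ℝ} {g : ℝ → ℝ} (hg : MemLp g 2 (vol a b)) :
    ApproxBy a b 0 0 (∫ x in a..b, g x ^ 2) g :=
  ⟨_, isEnergy_integral_sq hg, le_rfl, fun y z _ _ _ => ⟨0, by simp, by simp⟩⟩

lemma ApproxBy.add {a b τ K K' : ℝ} {d : ℕ} {f g : ℝ → ℝ} (hf : ApproxBy a b d τ K f)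
    (hg : ApproxBy a b d τ K' g) (hf2 : MemLp f 2 (vol a b)) (hg2 : MemLp g 2 (vol a b)) :
    ApproxBy a b d τ (2 * K + 2 * K') fun x => f x + g x := by
  obtain ⟨η, h1, h2, h3⟩ := hf
  obtain ⟨θ, k1, k2, k3⟩ := hg
  refine ⟨_, (h1.const_mul zero_le_two).add (k1.const_mul zero_le_two), by linarith,
    fun y z hy hyz hz => ?_⟩
  obtain ⟨q, hq, hq'⟩ := h3 y z hy hyz hz
  obtain ⟨p, hp, hp'⟩ := k3 y z hy hyz hz
  refine ⟨q + p, (degree_add_le _ _).trans_lt (max_lt hq hp), ?_⟩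
  have i1 := (memLp_sub hf2 hy hz).sub (memLp_eval y z q)
  have i2 := (memLp_sub hg2 hy hz).sub (memLp_eval y z p)
  have i3 := ((memLp_sub hf2 hy hz).add (memLp_sub hg2 hy hz)).sub (memLp_eval y z (q + p))
  have h4 : ∫ x in y..z, (f x + g x - (q + p).eval x) ^ 2 ≤
      ∫ x in y..z, (2 * (f x - q.eval x) ^ 2 + 2 * (g x - p.eval x) ^ 2) := by
    refine intervalIntegral.integral_mono_on hyz.le (intervalIntegrable_sq hyz.le i3)
      (((intervalIntegrable_sq hyz.le i1).const_mul 2).add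
        ((intervalIntegrable_sq hyz.le i2).const_mul 2)) fun x _ => ?_
    rw [eval_add]
    nlinarith [sq_nonneg ((f x - q.eval x) - (g x - p.eval x))]
  have h5 := intervalIntegral.integral_add ((intervalIntegrable_sq hyz.le i1).const_mul 2)
        ((intervalIntegrable_sq hyz.le i2).const_mul 2)
  simp only [Pi.sub_apply, intervalIntegral.integral_const_mul] at h5
  nlinarith

lemma exists_antiderivative {q : ℝ[X]} {d : ℕ} (hq : q.degree < d) :
    ∃ Q : ℝ[X], Q.degree < (d + 1 : ℕ) ∧ derivative Q = q := by
  have hq' : q ∈ degreeLT ℝ d := mem_degreeLT.2 hq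
  rw [degreeLT_eq_span_X_pow] at hq'
  refine Submodule.span_induction ?_ ⟨0, by simp⟩ ?_ ?_ hq'
  · intro x hx
    simp only [Finset.coe_image, Finset.coe_range, mem_image, mem_Iio] at hx
    obtain ⟨i, hi, rfl⟩ := hx
    refine ⟨C ((i + 1 : ℝ)⁻¹) * X ^ (i + 1), (degree_C_mul_X_pow_le _ _).trans_lt
      (by exact_mod_cast Nat.succ_lt_succ hi), ?_⟩
    rw [derivative_C_mul_X_pow]
    have : (i + 1 : ℝ) ≠ 0 := by positivity
    simp [this]
  · rintro x y - - ⟨P, hP, rfl⟩ ⟨Q, hQ, rfl⟩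
    exact ⟨P + Q, (degree_add_le _ _).trans_lt (max_lt hP hQ), derivative_add⟩
  · rintro c x - ⟨P, hP, rfl⟩
    exact ⟨c • P, (degree_smul_le _ _).trans_lt hP, derivative_smul _ _⟩

lemma exists_antiderivative_eval {q : ℝ[X]} {d : ℕ} (hq : q.degree < d) (y c : ℝ) :
    ∃ Q : ℝ[X], Q.degree < (d + 1 : ℕ) ∧ derivative Q = q ∧ Q.eval y = c := by
  obtain ⟨Q, h1, h2⟩ := exists_antiderivative hq
  refine ⟨Q + C (c - Q.eval y), (degree_add_le _ _).trans_lt (max_lt h1 ?_), by simp [h2], by simp⟩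
  exact degree_C_le.trans_lt (by exact_mod_cast d.succ_pos)

/-- Integrating an approximation of the derivative approximates the function uniformly. -/
lemma HasPrim.sub_eval_sq_le {a b y z : ℝ} {g g' : ℝ → ℝ} (hg : HasPrim a b g g')
    (hL : MemLp g' 2 (vol a b)) (hy : a ≤ y) (hz : z ≤ b) {Q : ℝ[X]}
    (hQ : Q.eval y = g y) {x : ℝ} (hx : x ∈ Icc y z) :
    (g x - Q.eval x) ^ 2 ≤ (z - y) * ∫ x in y..z, (g' x - (derivative Q).eval x) ^ 2 := by
  have h := (hg.sub (hasPrim_eval a b Q)).sub_sq_le (hL.sub (memLp_eval a b (derivative Q))) hy hz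
    (left_mem_Icc.2 (hx.1.trans hx.2)) hx
  simpa [hQ] using h

lemma integral_le_of_sq_le {y z c : ℝ} (hyz : y ≤ z) {g : ℝ → ℝ} (hc : MemLp g 2 (vol y z))
    (h : ∀ x ∈ Icc y z, g x ^ 2 ≤ c) : ∫ x in y..z, g x ^ 2 ≤ (z - y) * c := by
  have := intervalIntegral.integral_mono_on hyz (intervalIntegrable_sq hyz hc)
    (intervalIntegrable_const (c := c)) h
  simpa using this

/-- Let `Q` be an antiderivative of the approximation of `g'` with the same value as `g` at the left
end. Cauchy-Schwarz gives a pointwise bound of $(g-Q)^2$ with one factor of the length, and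
integrating it gives the second. The energy does not change. -/
lemma ApproxBy.of_hasPrim {a b τ K : ℝ} {d : ℕ} {g g' : ℝ → ℝ} (h : ApproxBy a b d τ K g')
    (hg : HasPrim a b g g') (hL : MemLp g' 2 (vol a b)) : ApproxBy a b (d + 1) (τ + 1) K g := by
  obtain ⟨η, h1, h2, h3⟩ := h
  refine ⟨η, h1, h2, fun y z hy hyz hz => ?_⟩
  obtain ⟨q, hq, hq'⟩ := h3 y z hy hyz hz
  obtain ⟨Q, k1, rfl, k3⟩ := exists_antiderivative_eval hq y (g y)
  refine ⟨Q, k1, ?_⟩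
  have hc := (hg.sub_interval hy hyz.le hz).continuousOn hyz.le
  have h4 := integral_le_of_sq_le hyz.le ((memLp_of_continuousOn hc).sub (memLp_eval y z Q))
    (fun x hx => hg.sub_eval_sq_le hL hy hz k3 hx)
  refine h4.trans ?_
  rw [show 2 * (τ + 1) = 2 * τ + (2 : ℕ) by push_cast; ring, Real.rpow_add (by linarith),
    Real.rpow_natCast]
  have h5 : 0 ≤ z - y := by linarith
  nlinarith [mul_le_mul_of_nonneg_left hq' (mul_nonneg h5 h5)]

/-- The product is approximated by a constant times an affine function. A constant in place of the
affine factor would give $|g-c|=O(\ell^{1/2})$ by Cauchy-Schwarz, which is too weak for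
$\sigma>1/2$; the affine one gives $O(\ell^{\sigma+1/2})$. This is why two coefficients are needed.
-/
lemma ApproxBy.mul_of_fractional {a b σ K K' M : ℝ} (hab : a < b) (hσ : 0 ≤ σ) {f g g' : ℝ → ℝ}
    (hf : ApproxBy a b 1 σ K f) (hf2 : MemLp f 2 (vol a b)) (hg : HasPrim a b g g')
    (hg2 : MemLp g' 2 (vol a b)) (hg' : ApproxBy a b 1 σ K' g')
    (hM : ∀ x ∈ Icc a b, g x ^ 2 ≤ M) :
    ApproxBy a b 2 σ (3 * ((b - a) * K' * (∫ x in a..b, f x ^ 2)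
      + (M + (b - a) * ((b - a) ^ (2 * σ) * K')) * K)) fun x => f x * g x := by
  obtain ⟨η, h1, h2, h3⟩ := hf
  obtain ⟨θ, k1, k2, k3⟩ := hg'
  have hba : 0 ≤ b - a := by linarith
  have hK' : 0 ≤ K' := (k1.nonneg a b le_rfl hab.le le_rfl).trans k2
  have hM0 : 0 ≤ M := (sq_nonneg _).trans (hM a (left_mem_Icc.2 hab.le))
  have hS0 : 0 ≤ (b - a) * ((b - a) ^ (2 * σ) * K') :=
    mul_nonneg hba (mul_nonneg (Real.rpow_nonneg hba _) hK')
  refine ⟨_, (((isEnergy_integral_sq hf2).const_mul (mul_nonneg hba hK')).add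
    (h1.const_mul (add_nonneg hM0 hS0))).const_mul zero_le_three, ?_, fun y z hy hyz hz => ?_⟩
  · gcongr
  obtain ⟨c, hc, hc'⟩ := h3 y z hy hyz hz
  obtain ⟨q, hq, hq'⟩ := k3 y z hy hyz hz
  obtain ⟨Q, l1, rfl, l3⟩ := exists_antiderivative_eval hq y (g y)
  have hyz0 : 0 ≤ z - y := by linarith
  have hP : 0 ≤ (z - y) ^ (2 * σ) := Real.rpow_nonneg hyz0 _
  have hPle : (z - y) ^ (2 * σ) ≤ (b - a) ^ (2 * σ) :=
    Real.rpow_le_rpow hyz0 (by linarith) (by linarith)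
  have hθ := k1.nonneg y z hy hyz.le hz
  have hθK : θ y z ≤ K' := (k1.le_total hy hyz.le hz).trans k2
  set S := (z - y) * ((z - y) ^ (2 * σ) * θ y z) with hS
  have hSx : ∀ x ∈ Icc y z, (g x - Q.eval x) ^ 2 ≤ S := fun x hx =>
    (hg.sub_eval_sq_le hg2 hy hz l3 hx).trans (mul_le_mul_of_nonneg_left hq' hyz0)
  -- `S` is used twice: against $f^2$ it must supply the power of the length, whereas against
  -- $(f-c)^2$, already small, a uniform bound suffices.
  have hS1 : S ≤ (z - y) ^ (2 * σ) * ((b - a) * K') := by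
    calc S = (z - y) ^ (2 * σ) * ((z - y) * θ y z) := by rw [hS]; ring
      _ ≤ _ := by gcongr
  have hS2 : S ≤ (b - a) * ((b - a) ^ (2 * σ) * K') := by
    rw [hS]; gcongr
  refine ⟨c * Q, ?_, ?_⟩
  · have e1 : c.degree ≤ 0 := by
      rw [← Nat.cast_zero, ← natDegree_le_iff_degree_le]
      rcases eq_or_ne c 0 with rfl | hne
      · simp
      · have := (natDegree_lt_iff_degree_lt hne).2 hc; omega
    rw [degree_mul]
    calc c.degree + Q.degree ≤ 0 + Q.degree := by gcongr
      _ = Q.degree := zero_add _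
      _ < _ := l1
  have if2 := memLp_sub hf2 hy hz
  have hcg := (hg.sub_interval hy hyz.le hz).continuousOn hyz.le
  have ifc := if2.sub (memLp_eval y z c)
  have h4 : ∫ x in y..z, (f x * g x - (c * Q).eval x) ^ 2 ≤
      ∫ x in y..z, (3 * S * f x ^ 2 + 3 * (M + S) * (f x - c.eval x) ^ 2) := by
    refine intervalIntegral.integral_mono_on hyz.le (intervalIntegrable_sq hyz.le
      ((memLp_mul_bounded if2 (memLp_top_of_continuousOn hcg)).sub (memLp_eval y z _)))
      (((intervalIntegrable_sq hyz.le if2).const_mul _).add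
        ((intervalIntegrable_sq hyz.le ifc).const_mul _)) fun x hx => ?_
    have hgx := hM x ⟨hy.trans hx.1, hx.2.trans hz⟩
    have hgQ := hSx x hx
    rw [eval_mul]
    -- This splitting needs uniform bounds only for `g` and `g - Q`; the possibly unbounded factors
    -- `f` and `f - c` stay in $L^2$.
    have e1 : f x * g x - c.eval x * Q.eval x = f x * (g x - Q.eval x)
      + (f x - c.eval x) * g x - (f x - c.eval x) * (g x - Q.eval x) := by ring
    rw [e1]
    generalize f x - c.eval x = u at *
    generalize g x - Q.eval x = v at *
    have e2 : (f x * v + u * g x - u * v) ^ 2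
        ≤ 3 * ((f x) ^ 2 * v ^ 2 + u ^ 2 * g x ^ 2 + u ^ 2 * v ^ 2) := by
      nlinarith [sq_nonneg (f x * v - u * g x), sq_nonneg (f x * v + u * v),
        sq_nonneg (u * g x + u * v)]
    nlinarith [mul_le_mul_of_nonneg_left hgQ (sq_nonneg (f x)),
      mul_le_mul_of_nonneg_left hgQ (sq_nonneg u), mul_le_mul_of_nonneg_left hgx (sq_nonneg u)]
  have h5 := intervalIntegral.integral_add ((intervalIntegrable_sq hyz.le if2).const_mul (3 * S))
        ((intervalIntegrable_sq hyz.le ifc).const_mul (3 * (M + S)))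
  simp only [Pi.sub_apply, intervalIntegral.integral_const_mul] at h5
  rw [h5] at h4
  refine h4.trans ?_
  have hf0 := integral_sq_nonneg hyz.le f
  have hfc0 := integral_sq_nonneg hyz.le fun x => f x - c.eval x
  calc 3 * S * (∫ x in y..z, f x ^ 2) + 3 * (M + S) * ∫ x in y..z, (f x - c.eval x) ^ 2
      ≤ 3 * ((z - y) ^ (2 * σ) * ((b - a) * K')) * (∫ x in y..z, f x ^ 2)
        + 3 * (M + (b - a) * ((b - a) ^ (2 * σ) * K')) * ((z - y) ^ (2 * σ) * η y z) := by
        have : 0 ≤ S := (sq_nonneg _).trans (hSx y (left_mem_Icc.2 hyz.le))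
        gcongr
    _ = _ := by ring

/-! ### Towers of primitives of Sobolev regularity -/

/-- `U 0, …, U m` are successive derivatives in `L²` with squared norms at most `K`, and `U m` is
locally approximated to order `σ` by polynomials of degree less than `δ`. -/
structure Reg (a b σ : ℝ) (δ m : ℕ) (K : ℝ) (U : ℕ → ℝ → ℝ) : Prop where
  prim : ∀ j < m, HasPrim a b (U j) (U (j + 1))
  memLp : ∀ j ≤ m, MemLp (U j) 2 (vol a b)
  bound : ∀ j ≤ m, ∫ x in a..b, U j x ^ 2 ≤ K
  approx : ApproxBy a b δ σ K (U m)

lemma Reg.nonneg {a b σ K : ℝ} {δ m : ℕ} {U : ℕ → ℝ → ℝ} (hab : a ≤ b)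
    (h : Reg a b σ δ m K U) : 0 ≤ K :=
  (integral_sq_nonneg hab _).trans (h.bound 0 m.zero_le)

lemma Reg.shift {a b σ K : ℝ} {δ m : ℕ} {U : ℕ → ℝ → ℝ} (h : Reg a b σ δ (m + 1) K U) :
    Reg a b σ δ m K fun j => U (j + 1) :=
  ⟨fun j hj => h.prim _ (by omega), fun j hj => h.memLp _ (by omega),
    fun j hj => h.bound _ (by omega), h.approx⟩

/-- The admissible pairs of a fractional order `σ` and the number of coefficients `δ` of the
polynomials needed for approximation of order `σ`. -/
def FracOrder (σ : ℝ) (δ : ℕ) : Prop := (σ = 0 ∧ δ = 0) ∨ (0 < σ ∧ σ < 1 ∧ δ = 1)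

lemma FracOrder.nonneg {σ : ℝ} {δ : ℕ} (h : FracOrder σ δ) : 0 ≤ σ := by
  rcases h with ⟨rfl, -⟩ | ⟨h, -⟩
  · exact le_rfl
  · exact h.le

/-- A spare derivative in $L^2$ gives approximation by constants to order one, hence to any
$\sigma<1$. The constant absorbs the unused power of the length and serves for $\sigma=0$ as well.
-/
lemma Reg.lower {a b σ K : ℝ} {δ m : ℕ} {U : ℕ → ℝ → ℝ} (hab : a ≤ b) (hσ : FracOrder σ δ)
    (h : Reg a b σ δ (m + 1) K U) : Reg a b σ δ m ((1 + (b - a) ^ (2 * (1 - σ))) * K) U := by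
  have hK := h.nonneg hab
  have hc : 0 ≤ (b - a) ^ (2 * (1 - σ)) := Real.rpow_nonneg (by linarith) _
  have hK1 : K ≤ (1 + (b - a) ^ (2 * (1 - σ))) * K := by nlinarith
  refine ⟨fun j hj => h.prim _ (by omega), fun j hj => h.memLp _ (by omega),
    fun j hj => (h.bound _ (by omega)).trans hK1, ?_⟩
  rcases hσ with ⟨rfl, rfl⟩ | ⟨-, hσ, rfl⟩
  · exact (approxBy_zero (h.memLp m (by omega))).mono_const ((h.bound m (by omega)).trans hK1)
  · have h1 := ((approxBy_zero (h.memLp (m + 1) le_rfl)).mono_const (h.bound _ le_rfl)).of_hasPrim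
      (h.prim m (by omega)) (h.memLp _ le_rfl)
    refine (h1.mono_exponent hab (τ' := σ) (by linarith)).mono_const ?_
    rw [zero_add]
    nlinarith

/-- One-dimensional Sobolev embedding: compare the value at `x` with that at `y` through the
derivative, then average over `y`. -/
lemma Reg.sup_sq_le {a b σ K : ℝ} {δ m : ℕ} {U : ℕ → ℝ → ℝ} (hab : a < b)
    (h : Reg a b σ δ (m + 1) K U) {x : ℝ} (hx : x ∈ Icc a b) :
    U 0 x ^ 2 ≤ (2 / (b - a) + 2 * (b - a)) * K := by
  have hp := h.prim 0 (by omega)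
  have hU := h.memLp 0 (by omega)
  have key : ∀ y ∈ Icc a b, U 0 x ^ 2 ≤ 2 * U 0 y ^ 2 + 2 * ((b - a) * K) := by
    intro y hy
    have h1 := hp.sub_sq_le (h.memLp 1 (by omega)) le_rfl le_rfl hy hx
    have h2 := h.bound 1 (by omega)
    have h3 : (b - a) * (∫ x in a..b, U (0 + 1) x ^ 2) ≤ (b - a) * K :=
      mul_le_mul_of_nonneg_left h2 (by linarith)
    nlinarith [sq_nonneg (U 0 x - 2 * U 0 y)]
  have i1 := (intervalIntegrable_sq hab.le hU).const_mul 2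
  have h4 := intervalIntegral.integral_mono_on hab.le (intervalIntegrable_const (c := U 0 x ^ 2))
    (i1.add (intervalIntegrable_const (c := 2 * ((b - a) * K)))) key
  rw [intervalIntegral.integral_add i1 intervalIntegrable_const,
    intervalIntegral.integral_const_mul] at h4
  simp only [intervalIntegral.integral_const, smul_eq_mul] at h4
  have hba : 0 < b - a := by linarith
  have h5 := h.bound 0 (by omega)
  rw [show (2 / (b - a) + 2 * (b - a)) * K = (2 * K + (b - a) * (2 * ((b - a) * K))) / (b - a) by
    field_simp, le_div_iff₀ hba]
  linarith

/-- The approximation of products of functions of Sobolev regularity. -/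
lemma exists_approxBy_mul {a b σ : ℝ} (hab : a < b) {δ : ℕ} (hσ : FracOrder σ δ) (m : ℕ) :
    ∃ C : ℝ, 0 ≤ C ∧ ∀ (K K' : ℝ) (A B : ℕ → ℝ → ℝ), Reg a b σ δ m K A →
      Reg a b σ δ (m + 1) K' B →
      ApproxBy a b (m + 2 * δ) (m + σ) (C * K * K') fun x => A 0 x * B 0 x := by
  have hba : 0 < b - a := by linarith
  have hP : 0 ≤ (b - a) ^ (2 * σ) := Real.rpow_nonneg hba.le _
  induction m with
  -- The constant covers both cases: for $\sigma=0$ only the supremum of `B` is needed, and for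
  -- $\sigma>0$ it comes from `ApproxBy.mul_of_fractional`.
  | zero =>
    refine ⟨3 * ((b - a) + ((2 / (b - a) + 2 * (b - a)) + (b - a) * (b - a) ^ (2 * σ))),
      by positivity, fun K K' A B hA hB => ?_⟩
    have hK := hA.nonneg hab.le
    have hK' := hB.nonneg hab.le
    have hAL := hA.memLp 0 le_rfl
    have hBc := (hB.prim 0 (by omega)).continuousOn hab.le
    have hsup : ∀ x ∈ Icc a b, B 0 x ^ 2 ≤ (2 / (b - a) + 2 * (b - a)) * K' :=
      fun x hx => hB.sup_sq_le hab hx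
    have hA0 := hA.bound 0 le_rfl
    rcases hσ with ⟨rfl, rfl⟩ | ⟨hσ, -, rfl⟩
    · have hAB := memLp_mul_bounded hAL (memLp_top_of_continuousOn hBc)
      have h1 : ∫ x in a..b, (A 0 x * B 0 x) ^ 2
          ≤ ∫ x in a..b, ((2 / (b - a) + 2 * (b - a)) * K') * A 0 x ^ 2 := by
        refine intervalIntegral.integral_mono_on hab.le (intervalIntegrable_sq hab.le hAB)
          ((intervalIntegrable_sq hab.le hAL).const_mul _) fun x hx => ?_
        rw [mul_pow, mul_comm]
        exact mul_le_mul_of_nonneg_right (hsup x hx) (sq_nonneg _)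
      rw [intervalIntegral.integral_const_mul] at h1
      have h2 := (approxBy_zero hAB).mono_const (h1.trans (mul_le_mul_of_nonneg_left hA0
        (by positivity)))
      simp only [Nat.cast_zero, add_zero, mul_zero]
      refine h2.mono_const ?_
      have h3 : 0 ≤ 2 * ((2 / (b - a) + 2 * (b - a)) * (K' * K)) := by positivity
      have h4 : 0 ≤ 3 * (((b - a) + (b - a) * (b - a) ^ (2 * (0 : ℝ))) * (K' * K)) := by positivity
      rw [mul_zero] at h4
      nlinarith
    · have h1 := ApproxBy.mul_of_fractional hab hσ.le hA.approx hAL (hB.prim 0 (by omega))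
        (hB.memLp 1 le_rfl) hB.approx hsup
      have h2 : (0 : ℕ) + 2 * 1 = 2 := rfl
      rw [h2, Nat.cast_zero, zero_add]
      refine h1.mono_const ?_
      calc _ ≤ 3 * ((b - a) * K' * K + ((2 / (b - a) + 2 * (b - a)) * K'
            + (b - a) * ((b - a) ^ (2 * σ) * K')) * K) := by gcongr
        _ = _ := by ring
  | succ m ih =>
    obtain ⟨C, hC, ih⟩ := ih
    set c := 1 + (b - a) ^ (2 * (1 - σ))
    have hc : 0 ≤ c := add_nonneg zero_le_one (Real.rpow_nonneg hba.le _)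
    refine ⟨4 * C * c, by positivity, fun K K' A B hA hB => ?_⟩
    -- In $A'B+AB'$ one factor loses an order by differentiation and the other is lowered to match,
    -- so `B` stays one order ahead of `A` in both products.
    have h1 := ih _ _ _ _ hA.shift (hB.lower hab.le hσ)
    have h2 := ih _ _ _ _ (hA.lower hab.le hσ) hB.shift
    have pA := hA.prim 0 (by omega)
    have pB := hB.prim 0 (by omega)
    have l1 := memLp_mul_bounded (hA.memLp 1 (by omega))
      (memLp_top_of_continuousOn (pB.continuousOn hab.le))
    have l2 := memLp_bounded_mul (memLp_top_of_continuousOn (pA.continuousOn hab.le))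
      (hB.memLp 1 (by omega))
    have h3 := (h1.add h2 l1 l2).of_hasPrim (pA.mul hab.le pB) (l1.add l2)
    have e1 : m + 1 + 2 * δ = m + 2 * δ + 1 := by ring
    have e2 : ((m + 1 : ℕ) : ℝ) + σ = m + σ + 1 := by push_cast; ring
    rw [e1, e2]
    refine h3.mono_const (le_of_eq ?_)
    ring

/-! ### The Slobodeckij seminorm -/

/-- Choose $x_0$ where the inner integral is at most its average over the interval, and approximate
by the constant $g(x_0)$. Since $|x_0-t|\le\ell$, multiplying the kernel by $\ell^{1+2\sigma}$
dominates $(g(t)-g(x_0))^2$, and averaging costs one factor $\ell$. The energy is superadditive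
because the squares over adjacent intervals are disjoint. -/
lemma exists_approxBy_slobodeckij {a b σ : ℝ} (hσ : 0 < σ) {g : ℝ → ℝ}
    (hg : MemLp g 2 (vol a b)) (hfin : slobodeckijSq a b σ g ≠ ⊤) :
    ApproxBy a b 1 σ (slobodeckijSq a b σ g).toReal g := by
  have hmono : ∀ y z, a ≤ y → z ≤ b → slobodeckijSq y z σ g ≤ slobodeckijSq a b σ g := by
    intro y z hy hz
    exact lintegral_mono' (Measure.restrict_mono (Ioo_subset_Ioo hy hz) le_rfl)
      fun x => lintegral_mono' (Measure.restrict_mono (Ioo_subset_Ioo hy hz) le_rfl) le_rfl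
  have hfin' : ∀ y z, a ≤ y → z ≤ b → slobodeckijSq y z σ g ≠ ⊤ := fun y z hy hz =>
    ne_top_of_le_ne_top hfin (hmono y z hy hz)
  refine ⟨fun y z => (slobodeckijSq y z σ g).toReal, ⟨fun _ _ _ _ _ => ENNReal.toReal_nonneg,
    fun y z w h1 h2 h3 h4 => ?_⟩, le_rfl, fun y z hy hyz hz => ?_⟩
  · rw [← ENNReal.toReal_add (hfin' _ _ h1 (h3.trans h4)) (hfin' _ _ (h1.trans h2) h4)]
    refine ENNReal.toReal_mono (hfin' _ _ h1 h4) ?_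
    have hd : Disjoint (Ioo y z) (Ioo z w) :=
      Set.disjoint_left.2 fun x hx hx' => (hx.2.trans hx'.1).false
    calc slobodeckijSq y z σ g + slobodeckijSq z w σ g
        ≤ (∫⁻ x in Ioo y z, ∫⁻ t in Ioo y w,
            ENNReal.ofReal ((g x - g t) ^ 2 / |x - t| ^ (1 + 2 * σ)))
          + ∫⁻ x in Ioo z w, ∫⁻ t in Ioo y w,
            ENNReal.ofReal ((g x - g t) ^ 2 / |x - t| ^ (1 + 2 * σ)) :=
          add_le_add
            (lintegral_mono fun x => lintegral_mono_set (Ioo_subset_Ioo_right h3))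
            (lintegral_mono fun x => lintegral_mono_set (Ioo_subset_Ioo_left h2))
      _ = ∫⁻ x in Ioo y z ∪ Ioo z w, ∫⁻ t in Ioo y w,
            ENNReal.ofReal ((g x - g t) ^ 2 / |x - t| ^ (1 + 2 * σ)) :=
          (lintegral_union measurableSet_Ioo hd).symm
      _ ≤ slobodeckijSq y w σ g :=
          lintegral_mono_set (union_subset (Ioo_subset_Ioo_right h3) (Ioo_subset_Ioo_left h2))
  · have hgl := memLp_sub hg hy hz
    have hgm : AEMeasurable g (vol y z) := hgl.1.aemeasurable
    have hF : AEMeasurable (fun p : ℝ × ℝ =>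
        ENNReal.ofReal ((g p.1 - g p.2) ^ 2 / |p.1 - p.2| ^ (1 + 2 * σ)))
        ((vol y z).prod (vol y z)) := by
      have h1 : AEMeasurable (fun p : ℝ × ℝ => g p.1) ((vol y z).prod (vol y z)) := hgm.comp_fst
      have h2 : AEMeasurable (fun p : ℝ × ℝ => g p.2) ((vol y z).prod (vol y z)) := hgm.comp_snd
      have h3 : Measurable fun p : ℝ × ℝ => |p.1 - p.2| ^ (1 + 2 * σ) := by fun_prop
      exact (((h1.sub h2).pow_const 2).div h3.aemeasurable).ennreal_ofReal
    have hv : volume (Ioo y z) = ENNReal.ofReal (z - y) := Real.volume_Ioo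
    have hh : 0 < z - y := by linarith
    obtain ⟨x₀, hx₀, hle⟩ := exists_le_setLAverage (μ := volume) (s := Ioo y z)
      (by simpa [hv] using hyz) (by simp [hv]) hF.lintegral_prod_right'
    rw [setLAverage_eq, hv] at hle
    refine ⟨C (g x₀), by simpa using (degree_C_le).trans_lt (by norm_num), ?_⟩
    have hI : ∫⁻ t in Ioo y z, ENNReal.ofReal ((g t - g x₀) ^ 2)
        ≤ ENNReal.ofReal ((z - y) ^ (1 + 2 * σ)) *
          (slobodeckijSq y z σ g / ENNReal.ofReal (z - y)) := by
      refine le_trans ?_ (mul_le_mul_right hle _)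
      rw [← lintegral_const_mul' _ _ ENNReal.ofReal_ne_top]
      refine setLIntegral_mono' measurableSet_Ioo fun t ht => ?_
      rw [← ENNReal.ofReal_mul (by positivity)]
      refine ENNReal.ofReal_le_ofReal ?_
      -- On the diagonal the kernel has denominator zero, but the left side vanishes there.
      rcases eq_or_ne x₀ t with rfl | hne
      · simp
      have hpos : 0 < |x₀ - t| := abs_pos.2 (sub_ne_zero.2 hne)
      have hlt : |x₀ - t| ≤ z - y := by
        rw [abs_le]; constructor <;> linarith [hx₀.1, hx₀.2, ht.1, ht.2]
      rw [mul_div_assoc', le_div_iff₀ (by positivity), sub_sq_comm, mul_comm]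
      exact mul_le_mul_of_nonneg_right (Real.rpow_le_rpow hpos.le hlt (by linarith)) (sq_nonneg _)
    have hmeas : AEStronglyMeasurable (fun t => (g t - (C (g x₀)).eval t) ^ 2) (vol y z) :=
      (hgl.1.sub (memLp_eval y z _).1).pow 2
    have hS : ∫ x in y..z, (g x - (C (g x₀)).eval x) ^ 2
        = (∫⁻ t in Ioo y z, ENNReal.ofReal ((g t - g x₀) ^ 2)).toReal := by
      rw [intervalIntegral.integral_of_le hyz.le, integral_Ioc_eq_integral_Ioo,
        integral_eq_lintegral_of_nonneg_ae (Filter.Eventually.of_forall fun _ => sq_nonneg _)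
        hmeas]
      simp
    rw [hS]
    refine (ENNReal.toReal_mono (ENNReal.mul_ne_top ENNReal.ofReal_ne_top
      (ENNReal.div_ne_top (hfin' y z hy hz) (by simpa using hyz))) hI).trans (le_of_eq ?_)
    rw [ENNReal.toReal_mul, ENNReal.toReal_div, ENNReal.toReal_ofReal (by positivity),
      ENNReal.toReal_ofReal hh.le, Real.rpow_add hh, Real.rpow_one]
    field_simp

/-- A function in `H^(m + σ)` is represented by a tower of primitives of this regularity. -/
lemma MemSobolev.exists_reg {a b σ : ℝ} (hab : a < b) {δ : ℕ} (hσ : FracOrder σ δ) {m : ℕ}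
    {u : ℝ → ℝ} (hu : MemSobolev a b (m + σ) u) :
    ∃ U : ℕ → ℝ → ℝ, Reg a b σ δ m (sobolevNorm a b (m + σ) u ^ 2) U ∧
      ∀ j, U j =ᵐ[vol a b] iterWeakDeriv a b j u := by
  have hσ0 := hσ.nonneg
  have hfl : ⌊(m : ℝ) + σ⌋₊ = m := by
    rw [add_comm, Nat.floor_add_natCast hσ0]
    have : ⌊σ⌋₊ = 0 := Nat.floor_eq_zero.2 (by rcases hσ with ⟨rfl, -⟩ | ⟨-, h, -⟩ <;> linarith)
    omega
  obtain ⟨h1, h2, h3⟩ := hu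
  rw [hfl] at h1 h2
  obtain ⟨U, k1, k2, k3⟩ := exists_primitive_chain hab h1 h2
  have hsq : sobolevNorm a b (m + σ) u ^ 2 = ∑ j ∈ Finset.range (m + 1),
      (eLpNorm (iterWeakDeriv a b j u) 2 (vol a b)).toReal ^ 2
      + (fractionalPartSq a b (m + σ) u).toReal := by
    rw [sobolevNorm, hfl, Real.sq_sqrt]
    exact add_nonneg (Finset.sum_nonneg fun _ _ => sq_nonneg _) ENNReal.toReal_nonneg
  have hnorm : ∀ j ≤ m, ∫ x in a..b, U j x ^ 2
      = (eLpNorm (iterWeakDeriv a b j u) 2 (vol a b)).toReal ^ 2 := by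
    intro j hj
    rw [← eLpNorm_congr_ae (k2 j), (k3 j hj).eLpNorm_eq_integral_rpow_norm (by simp) (by simp),
      ENNReal.toReal_ofReal (by positivity)]
    simp only [ENNReal.toReal_ofNat, Real.rpow_ofNat, Real.norm_eq_abs, sq_abs]
    rw [← one_div, ← Real.sqrt_eq_rpow, Real.sq_sqrt (integral_nonneg fun _ => sq_nonneg _),
      intervalIntegral.integral_of_le hab.le, integral_Ioc_eq_integral_Ioo]
  have hbound : ∀ j ≤ m, ∫ x in a..b, U j x ^ 2 ≤ sobolevNorm a b (m + σ) u ^ 2 := by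
    intro j hj
    rw [hnorm j hj, hsq]
    have := Finset.single_le_sum (f := fun j =>
      (eLpNorm (iterWeakDeriv a b j u) 2 (vol a b)).toReal ^ 2) (fun _ _ => sq_nonneg _)
      (Finset.mem_range.2 (Nat.lt_succ_of_le hj))
    exact this.trans (le_add_of_nonneg_right ENNReal.toReal_nonneg)
  refine ⟨U, ⟨k1, k3, hbound, ?_⟩, k2⟩
  rcases hσ with ⟨rfl, rfl⟩ | ⟨hσ, -, rfl⟩
  · exact (approxBy_zero (k3 m le_rfl)).mono_const (hbound m le_rfl)
  · have hfr : fractionalPartSq a b (m + σ) u = slobodeckijSq a b σ (iterWeakDeriv a b m u) := by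
      rw [fractionalPartSq, hfl, if_neg (by linarith), add_sub_cancel_left]
    rw [hfr] at h3 hsq
    refine ((exists_approxBy_slobodeckij hσ (h2 m le_rfl) h3).congr (k2 m).symm).mono_const ?_
    rw [hsq]
    exact le_add_of_nonneg_left (Finset.sum_nonneg fun _ _ => sq_nonneg _)

/-! ### The `L²` projection onto polynomials -/

/-- The $L^2$ pairing on $P_r$ is nondegenerate, so it represents the functional $q\mapsto\int gq$.
-/
lemma exists_projection (r : ℕ) {y z : ℝ} (h : y < z) {g : ℝ → ℝ} (hg : MemLp g 2 (vol y z)) :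
    ∃ p : ℝ[X], p.natDegree ≤ r ∧ ∀ q : ℝ[X], q.natDegree ≤ r →
      ∫ x in y..z, p.eval x * q.eval x = ∫ x in y..z, g x * q.eval x := by
  have hinj : Function.Injective (polyInner r y z) := by
    rw [← LinearMap.ker_eq_bot, LinearMap.ker_eq_bot']
    intro p hp
    have h1 : polyInner r y z p p = 0 := by rw [hp]; rfl
    exact Subtype.ext (eq_zero_of_integral_sq h p h1)
  have : FiniteDimensional ℝ (degreeLT ℝ (r + 1)) :=
    Module.Finite.equiv (degreeLTEquiv ℝ (r + 1)).symm
  have hsurj : Function.Surjective (polyInner r y z) :=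
    (LinearMap.injective_iff_surjective_of_finrank_eq_finrank
      (Subspace.dual_finrank_eq (K := ℝ)).symm).1 hinj
  let F : degreeLT ℝ (r + 1) →ₗ[ℝ] ℝ :=
    { toFun := fun q => ∫ x in y..z, g x * (q : ℝ[X]).eval x
      map_add' := fun q q' => by
        simp only [Submodule.coe_add, eval_add, mul_add]
        exact intervalIntegral.integral_add (intervalIntegrable_mul h.le hg (memLp_eval y z _))
          (intervalIntegrable_mul h.le hg (memLp_eval y z _))
      map_smul' := fun c q => by
        simp only [Submodule.coe_smul, eval_smul, smul_eq_mul, mul_left_comm _ c,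
          RingHom.id_apply, intervalIntegral.integral_const_mul] }
  obtain ⟨p, hp⟩ := hsurj F
  exact ⟨p, (mem_degreeLT_iff r _).1 p.2, fun q hq =>
    LinearMap.congr_fun hp ⟨q, (mem_degreeLT_iff r q).2 hq⟩⟩

lemma integral_eq_add {y z : ℝ} (hyz : y ≤ z) {F F' H T : ℝ → ℝ} (hF : MemLp F 2 (vol y z))
    (hF' : MemLp F' 2 (vol y z)) (hH : MemLp H 2 (vol y z))
    (hT : ∀ᵐ x ∂vol y z, T x = F x * H x + F' x * H x) :
    ∫ x in y..z, T x = (∫ x in y..z, F x * H x) + ∫ x in y..z, F' x * H x := by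
  rw [integral_congr_vol hyz hT, intervalIntegral.integral_add (intervalIntegrable_mul hyz hF hH)
    (intervalIntegrable_mul hyz hF' hH)]

lemma integral_add_sq {y z : ℝ} (hyz : y ≤ z) {f g : ℝ → ℝ} (hf : MemLp f 2 (vol y z))
    (hg : MemLp g 2 (vol y z)) : ∫ x in y..z, (f x + g x) ^ 2
      = (∫ x in y..z, f x ^ 2) + 2 * (∫ x in y..z, f x * g x) + ∫ x in y..z, g x ^ 2 := by
  have h1 := (intervalIntegrable_mul hyz hf hg).const_mul 2
  rw [← intervalIntegral.integral_const_mul,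
    ← intervalIntegral.integral_add (intervalIntegrable_sq hyz hf) h1,
    ← intervalIntegral.integral_add ((intervalIntegrable_sq hyz hf).add h1)
      (intervalIntegrable_sq hyz hg)]
  exact intervalIntegral.integral_congr fun x _ => by ring

/-- The `L²` projection is the best approximation. -/
lemma projection_error_le {r : ℕ} {y z : ℝ} (h : y ≤ z) {g : ℝ → ℝ} (hg : MemLp g 2 (vol y z))
    {p : ℝ[X]} (hp : p.natDegree ≤ r) (hp' : ∀ q : ℝ[X], q.natDegree ≤ r →
      ∫ x in y..z, p.eval x * q.eval x = ∫ x in y..z, g x * q.eval x)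
    {q : ℝ[X]} (hq : q.natDegree ≤ r) :
    ∫ x in y..z, (g x - p.eval x) ^ 2 ≤ ∫ x in y..z, (g x - q.eval x) ^ 2 := by
  -- The residual `g - p` is orthogonal to `p - q`, and Pythagoras concludes.
  have h1 := hp' (p - q) ((natDegree_sub_le_of_le hp hq).trans_eq (max_self r))
  have hgp := hg.sub (memLp_eval y z p)
  have h2 := integral_add_sq h hgp (memLp_eval y z (p - q))
  have h3 := integral_eq_add h hgp (memLp_eval y z p) (memLp_eval y z (p - q))
    (T := fun x => g x * (p - q).eval x)
    (Filter.Eventually.of_forall fun x => by simp only [Pi.sub_apply]; ring)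
  have h4 := integral_sq_nonneg h fun x => (p - q).eval x
  have h5 : ∫ x in y..z, (g x - q.eval x) ^ 2
      = ∫ x in y..z, ((g - fun x => p.eval x) x + (p - q).eval x) ^ 2 :=
    intervalIntegral.integral_congr fun x _ => by simp
  rw [h5, h2]
  simp only [Pi.sub_apply] at h3 ⊢
  linarith

/-! ### The discrete weak derivative on one element -/

lemma IsDiscreteWeakDeriv.sub {r : ℕ} {y z vy vz wy wz : ℝ} {v w p q : ℝ[X]}
    (hp : IsDiscreteWeakDeriv r y z v vy vz p) (hq : IsDiscreteWeakDeriv r y z w wy wz q) :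
    IsDiscreteWeakDeriv r y z (v - w) (vy - wy) (vz - wz) (p - q) := by
  refine ⟨(natDegree_sub_le_of_le hp.1 hq.1).trans_eq (max_self r), fun t ht => ?_⟩
  have e : ∀ f g s : ℝ[X], ∫ x in y..z, (f - g).eval x * s.eval x
      = (∫ x in y..z, f.eval x * s.eval x) - ∫ x in y..z, g.eval x * s.eval x := by
    intro f g s
    rw [← intervalIntegral.integral_sub (Continuous.intervalIntegrable (by fun_prop) _ _)
      (Continuous.intervalIntegrable (by fun_prop) _ _)]
    exact intervalIntegral.integral_congr fun x _ => by simp only [eval_sub]; ring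
  rw [e, e, hp.2 t ht, hq.2 t ht]
  ring

lemma natDegree_derivative_le_of_le {q : ℝ[X]} {k : ℕ} (hq : q.natDegree ≤ k + 1) :
    (derivative q).natDegree ≤ k :=
  (natDegree_derivative_le q).trans (by omega)

/-- The discrete weak derivative of the projection of `U` is the projection of `U'`. -/
lemma isDiscreteWeakDeriv_projection {k : ℕ} {a b y z : ℝ} {U U' : ℝ → ℝ} (hU : HasPrim a b U U')
    (hy : a ≤ y) (hyz : y ≤ z) (hz : z ≤ b) {p w : ℝ[X]}
    (hp : ∀ q : ℝ[X], q.natDegree ≤ k →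
      ∫ x in y..z, p.eval x * q.eval x = ∫ x in y..z, U x * q.eval x)
    (hw : w.natDegree ≤ k + 1) (hw' : ∀ q : ℝ[X], q.natDegree ≤ k + 1 →
      ∫ x in y..z, w.eval x * q.eval x = ∫ x in y..z, U' x * q.eval x) :
    IsDiscreteWeakDeriv (k + 1) y z p (U y) (U z) w := by
  refine ⟨hw, fun q hq => ?_⟩
  -- For `q` of degree at most $k+1$ the derivative lies in $P_k$, so `p` may be exchanged for `U`;
  -- this is the point of the choice $r=k+1$.
  rw [hw' q hq, hp _ (natDegree_derivative_le_of_le hq),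
    hU.integral_by_parts (hasPrim_eval a b q) hy hyz hz]

/-- The nodal values differ by the integral of the discrete weak derivative, and its primitive
dominates the interior part. -/
lemma IsDiscreteWeakDeriv.bounds {k : ℕ} {y z vy vz : ℝ} {v d : ℝ[X]} (hyz : y ≤ z)
    (h : IsDiscreteWeakDeriv (k + 1) y z v vy vz d) (hv : v.natDegree ≤ k) :
    |vz - vy| ≤ √((z - y) * ∫ x in y..z, d.eval x ^ 2) ∧
      ∫ x in y..z, v.eval x ^ 2
        ≤ (z - y) * (|vy| + √((z - y) * ∫ x in y..z, d.eval x ^ 2)) ^ 2 := by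
  obtain ⟨W, -, rfl, hWy⟩ := exists_antiderivative_eval (q := d) (d := d.natDegree + 1)
    (degree_le_natDegree.trans_lt (by exact_mod_cast Nat.lt_succ_self _)) y vy
  have hW := hasPrim_eval y z W
  have hWz : W.eval z = vz := by
    have h1 := h.2 1 (by simp)
    have h2 := hW.integral le_rfl hyz le_rfl
    simp only [eval_one, mul_one, derivative_one, eval_zero, mul_zero,
      intervalIntegral.integral_zero] at h1
    linarith
  have hbd : ∀ x ∈ Icc y z,
      |W.eval x - vy| ≤ √((z - y) * ∫ x in y..z, (derivative W).eval x ^ 2) := by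
    intro x hx
    rw [← hWy]
    exact Real.abs_le_sqrt (hW.sub_sq_le (memLp_eval y z _) le_rfl le_rfl
      (left_mem_Icc.2 hyz) hx)
  refine ⟨hWz ▸ hbd z (right_mem_Icc.2 hyz), ?_⟩
  -- An antiderivative of `v` is an admissible test polynomial. Comparison with integration by parts
  -- gives $\int v^2=\int Wv$, so $\int(W-v)^2\ge0$ becomes $\int v^2\le\int W^2$.
  obtain ⟨Q, hQ, hQ'⟩ := exists_antiderivative (q := v) (d := k + 1)
    (mem_degreeLT.1 ((mem_degreeLT_iff k v).2 hv))
  have hQd : Q.natDegree ≤ k + 1 := (mem_degreeLT_iff _ _).1 (mem_degreeLT.2 hQ)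
  have h1 := h.2 Q hQd
  have h2 := hW.integral_by_parts (hasPrim_eval y z Q) le_rfl hyz le_rfl
  simp only [hWz, hWy, hQ'] at h1 h2
  have h3 : ∫ x in y..z, v.eval x * v.eval x = ∫ x in y..z, W.eval x * v.eval x := by linarith
  have h4 := integral_sq_nonneg hyz fun x => W.eval x + (-v).eval x
  rw [integral_add_sq hyz (memLp_eval y z _) (memLp_eval y z _)] at h4
  simp only [eval_neg, mul_neg, intervalIntegral.integral_neg, even_two, Even.neg_pow] at h4
  have h5 : ∫ x in y..z, v.eval x ^ 2 = ∫ x in y..z, v.eval x * v.eval x := by simp only [sq]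
  have h6 := integral_le_of_sq_le hyz (memLp_eval y z W)
    (c := (|vy| + √((z - y) * ∫ x in y..z, (derivative W).eval x ^ 2)) ^ 2) (fun x hx => by
      rw [← sq_abs]
      refine pow_le_pow_left₀ (abs_nonneg _) ?_ 2
      calc |W.eval x| = |vy + (W.eval x - vy)| := by ring_nf
        _ ≤ |vy| + |W.eval x - vy| := abs_add_le _ _
        _ ≤ _ := add_le_add_right (hbd x hx) _)
  linarith

/-! ### Sums over partitions -/

lemma sum_succ_sub_castSucc {n : ℕ} (f : Fin (n + 1) → ℝ) :
    ∑ i : Fin n, (f i.succ - f i.castSucc) = f (Fin.last n) - f 0 := by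
  induction n with
  | zero => simp
  | succ n ih =>
    rw [Fin.sum_univ_castSucc]
    have := ih fun i => f i.castSucc
    simp only [Fin.succ_castSucc, Fin.castSucc_zero, Fin.succ_last] at this ⊢
    rw [this]
    ring

/-- Nodal values are partial sums of increments, starting from zero. The second claim has the form
of the bracket in the interior bound of `IsDiscreteWeakDeriv.bounds`. -/
lemma abs_nodal_add_le {n : ℕ} (v : Fin (n + 1) → ℝ) (h0 : v 0 = 0) (E : Fin n → ℝ)
    (hE : ∀ i, |v i.succ - v i.castSucc| ≤ E i) :
    (∀ i, |v i| ≤ ∑ j, E j) ∧ ∀ i : Fin n, |v i.castSucc| + E i ≤ ∑ j, E j := by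
  induction n with
  | zero => exact ⟨fun i => by rw [Fin.fin_one_eq_zero i, h0]; simp, fun i => i.elim0⟩
  | succ n ih =>
    obtain ⟨h1, h2⟩ := ih (fun i => v i.castSucc) h0 (fun i => E i.castSucc)
      (fun i => by simpa using hE i.castSucc)
    have hl := hE (Fin.last n)
    have hl0 := (abs_nonneg _).trans hl
    rw [Fin.sum_univ_castSucc]
    refine ⟨fun i => ?_, fun i => ?_⟩
    · induction i using Fin.lastCases with
      | last =>
        have h3 := h1 (Fin.last n)
        have h4 := abs_add_le (v (Fin.last n).castSucc)
          (v (Fin.last n).succ - v (Fin.last n).castSucc)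
        rw [add_sub_cancel] at h4
        rw [Fin.succ_last] at h4 hl
        linarith
      | cast i => linarith [h1 i]
    · induction i using Fin.lastCases with
      | last => linarith [h1 (Fin.last n)]
      | cast i => linarith [h2 i]

/-- The nodes need not reach the ends of $[a,b]$, so that the induction can drop the last one. -/
lemma IsEnergy.sum_le {a b : ℝ} {η : ℝ → ℝ → ℝ} (h : IsEnergy a b η) {n : ℕ}
    (x : Fin (n + 1) → ℝ) (hx : Monotone x) (h0 : a ≤ x 0) (h1 : x (Fin.last n) ≤ b) :
    ∑ i : Fin n, η (x i.castSucc) (x i.succ) ≤ η (x 0) (x (Fin.last n)) := by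
  induction n with
  | zero => simpa using h.nonneg _ _ h0 le_rfl h1
  | succ n ih =>
    rw [Fin.sum_univ_castSucc]
    have hl : x (Fin.last n).castSucc ≤ x (Fin.last n).succ := hx (Fin.castSucc_lt_succ).le
    have h2 := ih (fun i => x i.castSucc) (fun i j hij => hx (by simpa using hij)) h0
      (hl.trans (by simpa using h1))
    have h3 := h.add_le (x 0) (x (Fin.last n).castSucc) (x (Fin.last n).succ) h0
      (hx (Fin.zero_le _)) hl (by simpa using h1)
    simp only [Fin.succ_castSucc, Fin.castSucc_zero, Fin.succ_last] at h2 h3 ⊢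
    linarith

namespace Partition

variable {a b : ℝ} (M : Partition a b)

lemma lt_succ (i : Fin M.n) : M.node i.castSucc < M.node i.succ :=
  M.strictMono Fin.castSucc_lt_succ

lemma left_le (i : Fin (M.n + 1)) : a ≤ M.node i :=
  M.node_zero.symm.trans_le (M.strictMono.monotone (Fin.zero_le i))

lemma le_right (i : Fin (M.n + 1)) : M.node i ≤ b :=
  (M.strictMono.monotone (Fin.le_last i)).trans_eq M.node_last

lemma sum_length : ∑ i : Fin M.n, (M.node i.succ - M.node i.castSucc) = b - a := by
  rw [sum_succ_sub_castSucc, M.node_zero, M.node_last]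

lemma length_le_meshSize (i : Fin M.n) : M.node i.succ - M.node i.castSucc ≤ M.meshSize :=
  le_ciSup (f := fun i : Fin M.n => M.node i.succ - M.node i.castSucc) (finite_range _).bddAbove i

lemma meshSize_nonneg : 0 ≤ M.meshSize :=
  Real.iSup_nonneg fun i => (sub_pos.2 (M.lt_succ i)).le

lemma sum_energy_le {η : ℝ → ℝ → ℝ} (h : IsEnergy a b η) :
    ∑ i : Fin M.n, η (M.node i.castSucc) (M.node i.succ) ≤ η a b := by
  have := h.sum_le M.node M.strictMono.monotone M.node_zero.ge M.node_last.le
  rwa [M.node_zero, M.node_last] at this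

/-- The Cauchy-Schwarz inequality over a partition. -/
lemma sum_integral_mul_le {F H : Fin M.n → ℝ → ℝ} {S : ℝ} (hS : 0 ≤ S)
    (hF : ∀ i, MemLp (F i) 2 (vol (M.node i.castSucc) (M.node i.succ)))
    (hH : ∀ i, MemLp (H i) 2 (vol (M.node i.castSucc) (M.node i.succ)))
    (h : ∑ i, ∫ x in (M.node i.castSucc)..(M.node i.succ), F i x ^ 2 ≤ S ^ 2) :
    ∑ i, ∫ x in (M.node i.castSucc)..(M.node i.succ), F i x * H i x
      ≤ S * √(∑ i, ∫ x in (M.node i.castSucc)..(M.node i.succ), H i x ^ 2) := by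
  have hsq : ∀ (G : Fin M.n → ℝ → ℝ) (i : Fin M.n),
      √(∫ x in (M.node i.castSucc)..(M.node i.succ), G i x ^ 2) ^ 2
        = ∫ x in (M.node i.castSucc)..(M.node i.succ), G i x ^ 2 :=
    fun G i => Real.sq_sqrt (integral_sq_nonneg (M.lt_succ i).le _)
  refine (Finset.sum_le_sum fun i _ => (le_abs_self _).trans
    (abs_integral_mul_le (M.lt_succ i).le (hF i) (hH i))).trans ?_
  refine (Real.sum_mul_le_sqrt_mul_sqrt _ _ _).trans ?_
  simp only [hsq]
  exact mul_le_mul_of_nonneg_right ((Real.sqrt_le_left hS).2 h) (Real.sqrt_nonneg _)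

end Partition

/-! ### The error of the scheme in terms of approximation errors -/

/-- The contribution of one element to the error equation. -/
lemma error_identity {y z vy vz : ℝ} {k : ℕ} (hyz : y < z) {a₂ a₀ f U U' p G : ℝ → ℝ}
    (h2 : MemLp a₂ ⊤ (vol y z)) (h0 : MemLp a₀ ⊤ (vol y z))
    (hU : MemLp U 2 (vol y z)) (hU' : MemLp U' 2 (vol y z)) (hp : HasPrim y z p G)
    (hG : MemLp G 2 (vol y z)) (hpe : p =ᵐ[vol y z] fun x => a₂ x * U' x)
    (hf : G =ᵐ[vol y z] fun x => a₀ x * U x - f x)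
    {v π d w g ρ : ℝ[X]} (hd : IsDiscreteWeakDeriv (k + 1) y z v vy vz d)
    (hv : v.natDegree ≤ k)
    (hg : ∀ q : ℝ[X], q.natDegree ≤ k →
      ∫ x in y..z, g.eval x * q.eval x = ∫ x in y..z, G x * q.eval x)
    (hρ : ρ.natDegree ≤ k + 1) (hρg : derivative ρ = g) (hρy : ρ.eval y = p y) :
    (∫ x in y..z, a₂ x * (d + w).eval x * d.eval x)
      + (∫ x in y..z, a₀ x * (v + π).eval x * v.eval x) - ∫ x in y..z, f x * v.eval x
    = (∫ x in y..z, a₂ x * d.eval x ^ 2) + (∫ x in y..z, a₀ x * v.eval x ^ 2)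
      - (∫ x in y..z, (ρ.eval x - p x) * d.eval x)
      - (∫ x in y..z, (a₂ x * (U' x - w.eval x)) * d.eval x)
      - (∫ x in y..z, (a₀ x * (U x - π.eval x)) * v.eval x) + (vz * p z - vy * p y) := by
  have hpL : MemLp p 2 (vol y z) := memLp_of_continuousOn (hp.continuousOn hyz.le)
  have L := memLp_eval y z
  have hae : ∀ {P : ℝ → Prop}, (∀ x, P x) → ∀ᵐ x ∂vol y z, P x :=
    fun h => Filter.Eventually.of_forall h
  have i1 := integral_eq_add hyz.le (memLp_bounded_mul h2 (L d)) (memLp_bounded_mul h2 (L w)) (L d)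
    (T := fun x => a₂ x * (d + w).eval x * d.eval x) (hae fun x => by simp only [eval_add]; ring)
  have i2 := integral_eq_add hyz.le (memLp_bounded_mul h2 (hU'.sub (L w)))
    (memLp_bounded_mul h2 (L w)) (L d) (T := fun x => p x * d.eval x) (by
      filter_upwards [hpe] with x hx
      simp only [Pi.sub_apply, hx]; ring)
  have i3 := integral_eq_add hyz.le ((L ρ).sub hpL) hpL (L d)
    (T := fun x => d.eval x * ρ.eval x) (hae fun x => by simp only [Pi.sub_apply]; ring)
  have i4 := integral_eq_add hyz.le (memLp_bounded_mul h0 (L v)) (memLp_bounded_mul h0 (L π)) (L v)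
    (T := fun x => a₀ x * (v + π).eval x * v.eval x) (hae fun x => by simp only [eval_add]; ring)
  have i5 := integral_eq_add hyz.le (memLp_bounded_mul h0 (hU.sub (L π)))
    (memLp_bounded_mul h0 (L π)) (L v) (T := fun x => a₀ x * U x * v.eval x)
    (hae fun x => by simp only [Pi.sub_apply]; ring)
  have hfL : MemLp f 2 (vol y z) := by
    refine memLp_congr ((memLp_bounded_mul h0 hU).sub hG) ?_
    filter_upwards [hf] with x hx
    simp only [Pi.sub_apply, hx]; ring
  have i6 := integral_eq_add hyz.le hfL hG (L v) (T := fun x => a₀ x * U x * v.eval x) (by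
      filter_upwards [hf] with x hx
      simp only [hx]; ring)
  -- The test polynomial 1 shows that `ρ` and `p` have the same increment. Agreement at both ends
  -- makes the nodal terms telescope.
  have hρz : ρ.eval z = p z := by
    have e1 := hg 1 (by simp)
    have e2 := (hasPrim_eval y z ρ).integral le_rfl hyz.le le_rfl
    have e3 := hp.integral le_rfl hyz.le le_rfl
    simp only [eval_one, mul_one] at e1
    rw [hρg] at e2
    linarith
  have i7 := hd.2 ρ hρ
  rw [hρg, hρy, hρz] at i7
  have i8 := hg v hv
  have i9 : ∫ x in y..z, v.eval x * g.eval x = ∫ x in y..z, g.eval x * v.eval x :=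
    intervalIntegral.integral_congr fun x _ => mul_comm _ _
  have i10 : ∫ x in y..z, a₂ x * d.eval x ^ 2 = ∫ x in y..z, a₂ x * d.eval x * d.eval x :=
    intervalIntegral.integral_congr fun x _ => by ring
  have i11 : ∫ x in y..z, a₀ x * v.eval x ^ 2 = ∫ x in y..z, a₀ x * v.eval x * v.eval x :=
    intervalIntegral.integral_congr fun x _ => by ring
  simp only [Pi.sub_apply] at i2 i3 i5
  linarith

lemma integral_bounded_mul_sq_le {y z c : ℝ} (hyz : y ≤ z) {e g : ℝ → ℝ} (he : MemLp e ⊤ (vol y z))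
    (hg : MemLp g 2 (vol y z)) (hc : ∀ᵐ x ∂vol y z, |e x| ≤ c) :
    ∫ x in y..z, (e x * g x) ^ 2 ≤ c ^ 2 * ∫ x in y..z, g x ^ 2 := by
  rw [← intervalIntegral.integral_const_mul]
  refine integral_mono_vol hyz (intervalIntegrable_sq hyz (memLp_bounded_mul he hg))
    ((intervalIntegrable_sq hyz hg).const_mul _) ?_
  filter_upwards [hc] with x hx
  rw [mul_pow]
  exact mul_le_mul_of_nonneg_right (by rw [← sq_abs]; exact pow_le_pow_left₀ (abs_nonneg _) hx 2)
    (sq_nonneg _)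

/-- Minkowski's inequality for the broken $L^2$ norm. -/
lemma Partition.sum_integral_add_sq_le {a b : ℝ} (M : Partition a b) {F H : Fin M.n → ℝ → ℝ}
    {S : ℝ} (hS : 0 ≤ S) (hF : ∀ i, MemLp (F i) 2 (vol (M.node i.castSucc) (M.node i.succ)))
    (hH : ∀ i, MemLp (H i) 2 (vol (M.node i.castSucc) (M.node i.succ)))
    (h : ∑ i, ∫ x in (M.node i.castSucc)..(M.node i.succ), F i x ^ 2 ≤ S ^ 2) :
    √(∑ i, ∫ x in (M.node i.castSucc)..(M.node i.succ), (F i x + H i x) ^ 2)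
      ≤ √(∑ i, ∫ x in (M.node i.castSucc)..(M.node i.succ), H i x ^ 2) + S := by
  have h0 : 0 ≤ ∑ i, ∫ x in (M.node i.castSucc)..(M.node i.succ), H i x ^ 2 :=
    Finset.sum_nonneg fun i _ => integral_sq_nonneg (M.lt_succ i).le _
  have h1 := M.sum_integral_mul_le hS hF hH h
  refine Real.sqrt_le_iff.2 ⟨add_nonneg (Real.sqrt_nonneg _) hS, ?_⟩
  rw [Finset.sum_congr rfl fun i _ => integral_add_sq (M.lt_succ i).le (hF i) (hH i),
    Finset.sum_add_distrib, Finset.sum_add_distrib, ← Finset.mul_sum]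
  nlinarith [Real.sq_sqrt h0]

lemma exists_projections {a b : ℝ} (M : Partition a b) (r : ℕ) {g : ℝ → ℝ}
    (hg : MemLp g 2 (vol a b)) : ∃ p : Fin M.n → ℝ[X], (∀ i, (p i).natDegree ≤ r) ∧
      (∀ i, ∀ q : ℝ[X], q.natDegree ≤ r →
        ∫ x in (M.node i.castSucc)..(M.node i.succ), (p i).eval x * q.eval x
          = ∫ x in (M.node i.castSucc)..(M.node i.succ), g x * q.eval x) ∧
      ∀ i, ∀ q : ℝ[X], q.natDegree ≤ r →
        ∫ x in (M.node i.castSucc)..(M.node i.succ), (g x - (p i).eval x) ^ 2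
          ≤ ∫ x in (M.node i.castSucc)..(M.node i.succ), (g x - q.eval x) ^ 2 := by
  have hgi := fun i : Fin M.n => memLp_sub hg (M.left_le i.castSucc) (M.le_right i.succ)
  choose p hp hp' using fun i => exists_projection r (M.lt_succ i) (hgi i)
  exact ⟨p, hp, hp', fun i q hq =>
    projection_error_le (M.lt_succ i).le (hgi i) (hp i) (hp' i) hq⟩

/-- An energy argument with no regularity beyond the flux: `S₁`, `S₂`, `S₃` measure arbitrary
piecewise approximations of $p'$ (weighted by element length), $u'$ and $u$. They bound the
projection errors because projections are best approximations. -/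
theorem IsDiscreteSolution.error_le {a b : ℝ} (hab : a < b) {M : Partition a b} {k : ℕ}
    {a₂ a₀ f : ℝ → ℝ} {uh : WeakFunction M.n} (huh : IsDiscreteSolution M k (k + 1) a₂ a₀ f uh)
    {amin M₂ M₀ : ℝ} (hmin : 0 < amin) (h2 : ∀ᵐ x ∂vol a b, amin ≤ a₂ x)
    (h2m : MemLp a₂ ⊤ (vol a b)) (hM₂ : 0 ≤ M₂) (h2b : ∀ᵐ x ∂vol a b, |a₂ x| ≤ M₂)
    (h0 : ∀ᵐ x ∂vol a b, 0 ≤ a₀ x) (h0m : MemLp a₀ ⊤ (vol a b)) (hM₀ : 0 ≤ M₀)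
    (h0b : ∀ᵐ x ∂vol a b, |a₀ x| ≤ M₀) {U U' p G : ℝ → ℝ} (hU : HasPrim a b U U')
    (hU' : MemLp U' 2 (vol a b)) (hUa : U a = 0) (hp : HasPrim a b p G) (hG : MemLp G 2 (vol a b))
    (hpe : p =ᵐ[vol a b] fun x => a₂ x * U' x) (hpb : p b = 0)
    (hf : G =ᵐ[vol a b] fun x => a₀ x * U x - f x) {S₁ S₂ S₃ : ℝ} (hS₁ : 0 ≤ S₁) (hS₂ : 0 ≤ S₂)
    (hS₃ : 0 ≤ S₃) {q r t : Fin M.n → ℝ[X]} (hq : ∀ i, (q i).natDegree ≤ k)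
    (hr : ∀ i, (r i).natDegree ≤ k + 1) (ht : ∀ i, (t i).natDegree ≤ k)
    (hqS : ∑ i : Fin M.n, (M.node i.succ - M.node i.castSucc) ^ 2 *
      ∫ x in (M.node i.castSucc)..(M.node i.succ), (G x - (q i).eval x) ^ 2 ≤ S₁ ^ 2)
    (hrS : ∑ i : Fin M.n,
      ∫ x in (M.node i.castSucc)..(M.node i.succ), (U' x - (r i).eval x) ^ 2 ≤ S₂ ^ 2)
    (htS : ∑ i : Fin M.n,
      ∫ x in (M.node i.castSucc)..(M.node i.succ), (U x - (t i).eval x) ^ 2 ≤ S₃ ^ 2) :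
    √(∑ i, ∫ x in (M.node i.castSucc)..(M.node i.succ), ((uh.dw M (k + 1) i).eval x - U' x) ^ 2)
      ≤ (S₁ + M₂ * S₂ + M₀ * S₃ * (b - a)) / amin + S₂ ∧
    ∀ i, |uh.nodal i - U (M.node i)|
      ≤ √(b - a) * ((S₁ + M₂ * S₂ + M₀ * S₃ * (b - a)) / amin) := by
  have hlt := M.lt_succ
  have hy := fun i : Fin M.n => M.left_le i.castSucc
  have hz := fun i : Fin M.n => M.le_right i.succ
  have hUL : MemLp U 2 (vol a b) := memLp_of_continuousOn (hU.continuousOn hab.le)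
  have hpL : MemLp p 2 (vol a b) := memLp_of_continuousOn (hp.continuousOn hab.le)
  have loc : ∀ {e : ℝ≥0∞} {g : ℝ → ℝ}, MemLp g e (vol a b) →
      ∀ i : Fin M.n, MemLp g e (vol (M.node i.castSucc) (M.node i.succ)) :=
    fun h i => memLp_sub h (hy i) (hz i)
  have L := fun i : Fin M.n => memLp_eval (M.node i.castSucc) (M.node i.succ)
  obtain ⟨w, hw, hw', hwb⟩ := exists_projections M (k + 1) hU'
  obtain ⟨π, hπ, hπ', hπb⟩ := exists_projections M k hUL
  obtain ⟨g, hg, hg', hgb⟩ := exists_projections M k hG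
  choose ρ hρ hρg hρy using fun i => exists_antiderivative_eval
    (mem_degreeLT.1 ((mem_degreeLT_iff k (g i)).2 (hg i))) (M.node i.castSucc) (p (M.node i.castSucc))
  have hρd : ∀ i, (ρ i).natDegree ≤ k + 1 :=
    fun i => (mem_degreeLT_iff _ _).1 (mem_degreeLT.2 (hρ i))
  let e : WeakFunction M.n :=
    ⟨fun i => uh.interior i - π i, fun j => uh.nodal j - U (M.node j)⟩
  have heS : e.MemSh k := ⟨fun i => (natDegree_sub_le_of_le (huh.1.1 i) (hπ i)).trans_eq
    (max_self k), by simp [e, huh.1.2, M.node_zero, hUa]⟩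
  set d : Fin M.n → ℝ[X] := fun i => e.dw M (k + 1) i with hd_def
  have hd : ∀ i, IsDiscreteWeakDeriv (k + 1) (M.node i.castSucc) (M.node i.succ) (e.interior i)
      (e.nodal i.castSucc) (e.nodal i.succ) (d i) := fun i => discreteWeakDeriv_spec _ (hlt i) _ _ _
  -- Linearity and uniqueness of the discrete weak derivative, with `w` that of the projected exact
  -- solution.
  have hdw : ∀ i, uh.dw M (k + 1) i = d i + w i := by
    intro i
    have h3 := (discreteWeakDeriv_spec (k + 1) (hlt i) (uh.interior i) (uh.nodal i.castSucc)
      (uh.nodal i.succ)).sub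
      (isDiscreteWeakDeriv_projection hU (hy i) (hlt i).le (hz i) (hπ' i) (hw i) (hw' i))
    have h4 := (existsUnique_discreteWeakDeriv (k + 1) (hlt i) _ _ _).unique h3 (hd i)
    rw [← h4]
    simp [WeakFunction.dw]
  set D := ∑ i, ∫ x in (M.node i.castSucc)..(M.node i.succ), (d i).eval x ^ 2 with hD
  have hD0 : 0 ≤ D := Finset.sum_nonneg fun i _ => integral_sq_nonneg (hlt i).le _
  -- bounds for the nodal values and the interior part of the discrete error
  set E : Fin M.n → ℝ := fun i => √((M.node i.succ - M.node i.castSucc) *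
    ∫ x in (M.node i.castSucc)..(M.node i.succ), (d i).eval x ^ 2)
  have hbd := fun i => (hd i).bounds (hlt i).le (heS.1 i)
  have hnod := abs_nodal_add_le e.nodal heS.2 E fun i => (hbd i).1
  have hE0 : 0 ≤ ∑ i, E i := Finset.sum_nonneg fun i _ => Real.sqrt_nonneg _
  -- Cauchy-Schwarz over the elements; the lengths add up to $b-a$, so the number of elements does
  -- not enter.
  have hE : ∑ i, E i ≤ √(b - a) * √D := by
    have h3 := Real.sum_sqrt_mul_sqrt_le (s := Finset.univ)
      (f := fun i : Fin M.n => M.node i.succ - M.node i.castSucc)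
      (g := fun i => ∫ x in (M.node i.castSucc)..(M.node i.succ), (d i).eval x ^ 2)
      (fun i => (sub_pos.2 (hlt i)).le) (fun i => integral_sq_nonneg (hlt i).le _)
    rw [M.sum_length] at h3
    refine le_of_eq_of_le (Finset.sum_congr rfl fun i _ => ?_) h3
    exact Real.sqrt_mul (sub_pos.2 (hlt i)).le _
  have hint : ∑ i, ∫ x in (M.node i.castSucc)..(M.node i.succ), (e.interior i).eval x ^ 2
      ≤ (b - a) ^ 2 * D := by
    calc _ ≤ ∑ i : Fin M.n, (M.node i.succ - M.node i.castSucc) * (√(b - a) * √D) ^ 2 := by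
          refine Finset.sum_le_sum fun i _ => (hbd i).2.trans ?_
          refine mul_le_mul_of_nonneg_left (pow_le_pow_left₀ (add_nonneg (abs_nonneg _)
            (Real.sqrt_nonneg _)) ((hnod.2 i).trans hE) 2) (sub_pos.2 (hlt i)).le
      _ = _ := by
          rw [← Finset.sum_mul, M.sum_length, mul_pow, Real.sq_sqrt hD0,
            Real.sq_sqrt (sub_pos.2 hab).le]
          ring
  -- the consistency errors
  have c1 : ∑ i, ∫ x in (M.node i.castSucc)..(M.node i.succ), ((ρ i).eval x - p x) ^ 2
      ≤ S₁ ^ 2 := by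
    refine (Finset.sum_le_sum fun i _ => ?_).trans hqS
    have h3 := integral_le_of_sq_le (hlt i).le ((loc hpL i).sub (L i (ρ i)))
      (fun x hx => hp.sub_eval_sq_le hG (hy i) (hz i) (hρy i) hx)
    have h4 : ∫ x in (M.node i.castSucc)..(M.node i.succ), ((ρ i).eval x - p x) ^ 2
        = ∫ x in (M.node i.castSucc)..(M.node i.succ), (p - fun x => (ρ i).eval x) x ^ 2 :=
      intervalIntegral.integral_congr fun x _ => sub_sq_comm _ _
    rw [h4]
    refine h3.trans ?_
    rw [hρg, ← mul_assoc, ← sq]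
    exact mul_le_mul_of_nonneg_left (hgb i _ (hq i)) (sq_nonneg _)
  have c2' : ∑ i, ∫ x in (M.node i.castSucc)..(M.node i.succ), (U' x - (w i).eval x) ^ 2
      ≤ S₂ ^ 2 := (Finset.sum_le_sum fun i _ => hwb i _ (hr i)).trans hrS
  have c2 : ∑ i, ∫ x in (M.node i.castSucc)..(M.node i.succ), (a₂ x * (U' x - (w i).eval x)) ^ 2
      ≤ (M₂ * S₂) ^ 2 := by
    rw [mul_pow]
    refine le_trans ?_ (mul_le_mul_of_nonneg_left c2' (sq_nonneg M₂))
    rw [Finset.mul_sum]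
    exact Finset.sum_le_sum fun i _ => integral_bounded_mul_sq_le (hlt i).le (loc h2m i)
      ((loc hU' i).sub (L i (w i))) (ae_vol_sub (hy i) (hz i) h2b)
  have c3 : ∑ i, ∫ x in (M.node i.castSucc)..(M.node i.succ), (a₀ x * (U x - (π i).eval x)) ^ 2
      ≤ (M₀ * S₃) ^ 2 := by
    rw [mul_pow]
    refine le_trans ?_ (mul_le_mul_of_nonneg_left
      ((Finset.sum_le_sum fun i _ => hπb i _ (ht i)).trans htS) (sq_nonneg M₀))
    rw [Finset.mul_sum]
    exact Finset.sum_le_sum fun i _ => integral_bounded_mul_sq_le (hlt i).le (loc h0m i)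
      ((loc hUL i).sub (L i (π i))) (ae_vol_sub (hy i) (hz i) h0b)
  have t1 := M.sum_integral_mul_le hS₁ (fun i => (L i (ρ i)).sub (loc hpL i))
    (fun i => L i (d i)) c1
  have t2 := M.sum_integral_mul_le (mul_nonneg hM₂ hS₂)
    (fun i => memLp_bounded_mul (loc h2m i) ((loc hU' i).sub (L i (w i)))) (fun i => L i (d i)) c2
  have t3 := M.sum_integral_mul_le (mul_nonneg hM₀ hS₃)
    (fun i => memLp_bounded_mul (loc h0m i) ((loc hUL i).sub (L i (π i))))
    (fun i => L i (e.interior i)) c3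
  have t3' : √(∑ i, ∫ x in (M.node i.castSucc)..(M.node i.succ), (e.interior i).eval x ^ 2)
      ≤ (b - a) * √D := by
    refine (Real.sqrt_le_sqrt hint).trans_eq ?_
    rw [Real.sqrt_mul (sq_nonneg _), Real.sqrt_sq (sub_pos.2 hab).le]
  -- the error equation
  have heq := huh.2 e heS
  have hid := fun i => error_identity (w := w i) (π := π i) (hlt i) (loc h2m i) (loc h0m i)
    (loc hUL i) (loc hU' i) (hp.sub_interval (hy i) (hlt i).le (hz i)) (loc hG i)
    (ae_vol_sub (hy i) (hz i) hpe) (ae_vol_sub (hy i) (hz i) hf) (hd i) (heS.1 i) (hg' i) (hρd i)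
    (hρg i) (hρy i)
  have hsum := Finset.sum_congr rfl fun i (_ : i ∈ Finset.univ) => hid i
  -- The nodal terms sum to $e(b)p(b)-e(a)p(a)=0$: the natural condition at `b` and the essential
  -- one at `a`.
  have htel := sum_succ_sub_castSucc fun j => e.nodal j * p (M.node j)
  rw [M.node_last, hpb, heS.2] at htel
  simp only [Finset.sum_add_distrib, Finset.sum_sub_distrib] at hsum htel
  have hint_eq : ∀ i, e.interior i + π i = uh.interior i := fun i => by simp [e]
  simp only [hint_eq, ← hdw] at hsum
  have h2D : amin * D ≤ ∑ i, ∫ x in (M.node i.castSucc)..(M.node i.succ),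
      a₂ x * (d i).eval x ^ 2 := by
    rw [hD, Finset.mul_sum]
    refine Finset.sum_le_sum fun i _ => ?_
    rw [← intervalIntegral.integral_const_mul]
    have hi := intervalIntegrable_mul (hlt i).le (memLp_bounded_mul (loc h2m i) (L i (d i)))
      (L i (d i))
    simp only [mul_assoc, ← sq] at hi
    refine integral_mono_vol (hlt i).le ((intervalIntegrable_sq (hlt i).le (L i (d i))).const_mul _)
      hi ?_
    filter_upwards [ae_vol_sub (hy i) (hz i) h2] with x hx
    exact mul_le_mul_of_nonneg_right hx (sq_nonneg _)
  have h0D : 0 ≤ ∑ i, ∫ x in (M.node i.castSucc)..(M.node i.succ),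
      a₀ x * (e.interior i).eval x ^ 2 := by
    refine Finset.sum_nonneg fun i _ => ?_
    rw [intervalIntegral.integral_of_le (hlt i).le, integral_Ioc_eq_integral_Ioo]
    refine integral_nonneg_of_ae ?_
    filter_upwards [ae_vol_sub (hy i) (hz i) h0] with x hx
    exact mul_nonneg hx (sq_nonneg _)
  simp only [Pi.sub_apply] at t1 t2 t3
  have hmain : amin * D ≤ (S₁ + M₂ * S₂ + M₀ * S₃ * (b - a)) * √D := by
    have h5 := mul_le_mul_of_nonneg_left t3' (mul_nonneg hM₀ hS₃)
    nlinarith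
  have hN : √D ≤ (S₁ + M₂ * S₂ + M₀ * S₃ * (b - a)) / amin := by
    rw [le_div_iff₀ hmin]
    rcases (Real.sqrt_nonneg D).eq_or_lt with h | h
    · rw [← h, zero_mul]
      have := (sub_pos.2 hab).le
      positivity
    · refine le_of_mul_le_mul_right ?_ h
      calc √D * amin * √D = amin * (√D * √D) := by ring
        _ = amin * D := by rw [Real.mul_self_sqrt hD0]
        _ ≤ _ := hmain
  refine ⟨?_, fun i => ((hnod.1 i).trans hE).trans
    (mul_le_mul_of_nonneg_left hN (Real.sqrt_nonneg _))⟩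
  have h6 := M.sum_integral_add_sq_le hS₂ (fun i => (loc hU' i).sub (L i (w i)))
    (fun i => L i (-d i)) c2'
  simp only [eval_neg, even_two, Even.neg_pow] at h6
  refine le_trans (le_of_eq ?_) (h6.trans (add_le_add_left hN S₂))
  congr 1
  refine Finset.sum_congr rfl fun i _ => intervalIntegral.integral_congr fun x _ => ?_
  simp only [hdw, eval_add, Pi.sub_apply]
  ring

/-! ### Convergence of the scheme -/

lemma Reg.approx_zero {a b σ K : ℝ} {δ m : ℕ} {U : ℕ → ℝ → ℝ} (h : Reg a b σ δ m K U) :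
    ApproxBy a b (m + δ) (m + σ) K (U 0) := by
  induction m generalizing U with
  | zero => simpa using h.approx
  | succ m ih =>
    have h1 := (ih h.shift).of_hasPrim (h.prim 0 (by omega)) (h.memLp 1 (by omega))
    have e1 : m + 1 + δ = m + δ + 1 := by ring
    have e2 : ((m + 1 : ℕ) : ℝ) + σ = m + σ + 1 := by push_cast; ring
    rwa [e1, e2]

/-- Superadditivity bounds the sum of the local energies by the total one, uniformly in the
partition. -/
lemma ApproxBy.exists_piecewise {a b τ K : ℝ} {d : ℕ} {g : ℝ → ℝ} (h : ApproxBy a b d τ K g)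
    (hτ : 0 ≤ τ) (M : Partition a b) : ∃ q : Fin M.n → ℝ[X], (∀ i, (q i).degree < d) ∧
      ∑ i : Fin M.n, ∫ x in (M.node i.castSucc)..(M.node i.succ), (g x - (q i).eval x) ^ 2
        ≤ M.meshSize ^ (2 * τ) * K := by
  obtain ⟨η, h1, h2, h3⟩ := h
  choose q hq hq' using fun i : Fin M.n => h3 _ _ (M.left_le i.castSucc) (M.lt_succ i)
    (M.le_right i.succ)
  have hP : 0 ≤ M.meshSize ^ (2 * τ) := Real.rpow_nonneg M.meshSize_nonneg _
  refine ⟨q, hq, ?_⟩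
  calc _ ≤ ∑ i : Fin M.n, M.meshSize ^ (2 * τ) * η (M.node i.castSucc) (M.node i.succ) := by
        refine Finset.sum_le_sum fun i _ => (hq' i).trans ?_
        exact mul_le_mul_of_nonneg_right (Real.rpow_le_rpow (sub_pos.2 (M.lt_succ i)).le
          (M.length_le_meshSize i) (by linarith))
          (h1.nonneg _ _ (M.left_le _) (M.lt_succ i).le (M.le_right _))
    _ ≤ _ := by
        rw [← Finset.mul_sum]
        exact mul_le_mul_of_nonneg_left ((M.sum_energy_le h1).trans h2) hP

lemma natDegree_le_of_degree_lt {q : ℝ[X]} {d k : ℕ} (hq : q.degree < d) (hd : d ≤ k + 1) :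
    q.natDegree ≤ k :=
  (mem_degreeLT_iff k q).1 (mem_degreeLT.2 (hq.trans_le (by exact_mod_cast hd)))

lemma exists_ae_bound {a b : ℝ} {g : ℝ → ℝ} (hg : MemLp g ⊤ (vol a b)) :
    ∃ B : ℝ, 0 ≤ B ∧ ∀ᵐ x ∂vol a b, |g x| ≤ B := by
  refine ⟨(eLpNorm g ⊤ (vol a b)).toReal, ENNReal.toReal_nonneg, ?_⟩
  have h := ae_le_eLpNormEssSup (f := g) (μ := vol a b)
  rw [← eLpNorm_exponent_top] at h
  filter_upwards [h] with x hx
  rw [← Real.norm_eq_abs, ← toReal_enorm]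
  exact ENNReal.toReal_mono hg.2.ne hx

/-- For `A` the coefficient and `V` the tower of $u'$ this is $(a_2u')'$. In each term the
undifferentiated factor is one order smoother, as `exists_approxBy_mul` requires. -/
lemma Reg.approx_flux_deriv {a b σ : ℝ} (hab : a < b) {δ : ℕ} (hσ : FracOrder σ δ) (m : ℕ) :
    ∃ C : ℝ, 0 ≤ C ∧ ∀ (K K' : ℝ) (A V : ℕ → ℝ → ℝ), Reg a b σ δ (m + 1) K A →
      Reg a b σ δ (m + 1) K' V →
      ApproxBy a b (m + 2 * δ) (m + σ) (C * K * K') (fun x => A 1 x * V 0 x + A 0 x * V 1 x) ∧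
      MemLp (fun x => A 1 x * V 0 x + A 0 x * V 1 x) 2 (vol a b) := by
  obtain ⟨C, hC, h⟩ := exists_approxBy_mul hab hσ m
  refine ⟨4 * C, by positivity, fun K K' A V hA hV => ?_⟩
  have h1 := h _ _ _ _ hA.shift hV
  have h2 := h _ _ _ _ hV.shift hA
  have l1 := memLp_mul_bounded (hA.memLp 1 (by omega))
    (memLp_top_of_continuousOn ((hV.prim 0 (by omega)).continuousOn hab.le))
  have l2 := memLp_bounded_mul
    (memLp_top_of_continuousOn ((hA.prim 0 (by omega)).continuousOn hab.le))
    (hV.memLp 1 (by omega))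
  have h2' : ApproxBy a b (m + 2 * δ) (m + σ) (C * K' * K) fun x => A 0 x * V 1 x :=
    h2.congr (Filter.Eventually.of_forall fun x => mul_comm _ _)
  exact ⟨(h1.add h2' l1 l2).mono_const (le_of_eq (by ring)), l1.add l2⟩

/-- Both parts of the theorem, with $s=m+\sigma$. The condition `hk` makes the approximation of the
flux derivative fit into $P_k$, and also that of $u'$ into $P_{k+1}$. Approximating $u$ in $P_k$ to
order $s+1$ needs `m + δ ≤ k`, unless the reaction term is absent. -/
theorem exists_error_estimate {a b : ℝ} (hab : a < b) {amin : ℝ} {a₂ a₀ : ℝ → ℝ}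
    (hcoef : IsCoefficients a b amin a₂ a₀) {σ : ℝ} {δ : ℕ} (hσ : FracOrder σ δ) {m k : ℕ}
    (hk : m + 2 * δ ≤ k + 1) (hk0 : m + δ ≤ k ∨ a₀ =ᵐ[vol a b] 0)
    (ha₂ : MemSobolev a b ((m + 1 : ℕ) + σ) a₂) :
    ∃ C : ℝ, 0 < C ∧ ∀ f u : ℝ → ℝ, MemLp f 2 (vol a b) → IsExactSolution a b a₂ a₀ f u →
      MemSobolev a b ((m + 2 : ℕ) + σ) u → ∀ (M : Partition a b) (uh : WeakFunction M.n),
      IsDiscreteSolution M k (k + 1) a₂ a₀ f uh →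
      derivError M (k + 1) u uh
        ≤ C * M.meshSize ^ (m + σ + 1) * sobolevNorm a b ((m + 2 : ℕ) + σ) u ∧
      nodalError M u uh
        ≤ C * M.meshSize ^ (m + σ + 1) * sobolevNorm a b ((m + 2 : ℕ) + σ) u := by
  obtain ⟨A, hA, hAe⟩ := ha₂.exists_reg hab hσ
  set KA := sobolevNorm a b ((m + 1 : ℕ) + σ) a₂ ^ 2
  have hAc := (hA.prim 0 (by omega)).continuousOn hab.le
  have hAe0 : A 0 =ᵐ[vol a b] a₂ := hAe 0
  have ha₂m : MemLp a₂ ⊤ (vol a b) := (memLp_congr_ae hAe0).1 (memLp_top_of_continuousOn hAc)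
  obtain ⟨M₂, hM₂, hM₂b⟩ := exists_ae_bound ha₂m
  obtain ⟨M₀, hM₀, hM₀b, hM₀0⟩ : ∃ M₀ : ℝ, 0 ≤ M₀ ∧ (∀ᵐ x ∂vol a b, |a₀ x| ≤ M₀) ∧
      (m + δ ≤ k ∨ M₀ = 0) := by
    rcases hk0 with h | h
    · obtain ⟨M₀, h1, h2⟩ := exists_ae_bound hcoef.a₀_bounded
      exact ⟨M₀, h1, h2, Or.inl h⟩
    · refine ⟨0, le_rfl, ?_, Or.inr rfl⟩
      filter_upwards [h] with x hx
      simp [hx]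
  obtain ⟨C₁, hC₁, hflux⟩ := Reg.approx_flux_deriv hab hσ m
  have hba : 0 < b - a := sub_pos.2 hab
  have hamin := hcoef.amin_pos
  have hσ0 := hσ.nonneg
  set c := 1 + (b - a) ^ (2 * (1 - σ))
  have hc : 0 ≤ c := add_nonneg zero_le_one (Real.rpow_nonneg hba.le _)
  set S := (√(C₁ * KA) + M₂ + M₀ * √c * (b - a)) / amin with hS
  have hS0 : 0 ≤ S := by positivity
  -- The derivative error needs `S + 1`, the 1 being for the projection of $u'$; the nodal error
  -- needs `√(b - a) * S`.
  refine ⟨S + 1 + √(b - a) * S, by positivity, fun f u hf hu hus M uh huh => ?_⟩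
  obtain ⟨U, hU, hUe⟩ := hus.exists_reg hab hσ
  set N := sobolevNorm a b ((m + 2 : ℕ) + σ) u
  have hN : 0 ≤ N := Real.sqrt_nonneg _
  have hUe0 : U 0 =ᵐ[vol a b] u := hUe 0
  have hUe1 : U 1 =ᵐ[vol a b] weakDeriv a b u := hUe 1
  have hU0 : HasPrim a b (U 0) (U 1) := hU.prim 0 (by omega)
  have hUc := hU0.continuousOn hab.le
  have hU1c := (hU.prim 1 (by omega)).continuousOn hab.le
  have hUu : EqOn (U 0) u (Icc a b) := eqOn_of_ae_eq hab hUe0 hUc hu.continuousOn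
  obtain ⟨W, hWc, hWe, hWb⟩ := hu.right
  have hU1b : U 1 b = 0 := by
    rw [← hWb]
    exact eqOn_of_ae_eq hab (hUe1.trans hWe.symm) hU1c hWc (right_mem_Icc.2 hab.le)
  have hV := hU.shift
  obtain ⟨hGapp, hGL⟩ := hflux _ _ _ _ hA hV
  set p : ℝ → ℝ := fun x => A 0 x * U 1 x
  set G : ℝ → ℝ := fun x => A 1 x * U 1 x + A 0 x * U 2 x
  have hpG : HasPrim a b p G := (hA.prim 0 (by omega)).mul hab.le (hU.prim 1 (by omega))
  have hpe : p =ᵐ[vol a b] fun x => a₂ x * U 1 x := by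
    filter_upwards [hAe0] with x hx
    simp only [p, hx]
  have hfL : MemLp (fun x => a₀ x * u x - f x) 2 (vol a b) :=
    (memLp_bounded_mul hcoef.a₀_bounded (memLp_of_continuousOn hu.continuousOn)).sub hf
  have hGf : G =ᵐ[vol a b] fun x => a₀ x * U 0 x - f x := by
    have hpw : p =ᵐ[vol a b] fun x => a₂ x * weakDeriv a b u x := by
      filter_upwards [hpe, hUe1] with x h1 h2
      rw [h1, h2]
    -- The equation gives a second primitive representation of the same flux, so its derivative
    -- agrees with `G` almost everywhere.
    obtain ⟨P, hP, hPe⟩ := hu.equation.exists_hasPrim hab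
      ((memLp_congr (memLp_of_continuousOn (hpG.continuousOn hab.le)) hpw).integrable one_le_two)
      (hfL.integrable one_le_two)
    have hPp := eqOn_of_ae_eq hab (hPe.trans hpw.symm) (hP.continuousOn hab.le)
      (hpG.continuousOn hab.le)
    refine (hpG.ae_eq hab.le (hP.congr_left hab.le hPp)).trans ?_
    filter_upwards [hUe0] with x hx
    rw [hx]
  have hh := M.meshSize_nonneg
  set H := M.meshSize ^ (m + σ + 1) with hH
  have hH0 : 0 ≤ H := Real.rpow_nonneg hh _
  have hms : 0 ≤ (m : ℝ) + σ := by positivity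
  have hHsq : H ^ 2 = M.meshSize ^ (2 * (m + σ + 1)) := by
    rw [hH, ← Real.rpow_natCast, ← Real.rpow_mul hh]
    congr 1; push_cast; ring
  have hH2 : H ^ 2 = M.meshSize ^ 2 * M.meshSize ^ (2 * (m + σ)) := by
    rw [hHsq, ← Real.rpow_natCast, ← Real.rpow_add_of_nonneg hh (by positivity) (by positivity)]
    congr 1; push_cast; ring
  have e1 : ((m + 1 : ℕ) : ℝ) + σ = m + σ + 1 := by push_cast; ring
  obtain ⟨q, hq, hqS⟩ := hGapp.exists_piecewise hms M
  obtain ⟨r, hr, hrS⟩ := hV.approx_zero.exists_piecewise (by positivity) M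
  rw [e1, ← hHsq] at hrS
  have hqS' : ∑ i : Fin M.n, (M.node i.succ - M.node i.castSucc) ^ 2 *
      ∫ x in (M.node i.castSucc)..(M.node i.succ), (G x - (q i).eval x) ^ 2
        ≤ (√(C₁ * KA) * (H * N)) ^ 2 := by
    have hKA : 0 ≤ C₁ * KA := mul_nonneg hC₁ (sq_nonneg _)
    calc _ ≤ ∑ i : Fin M.n, M.meshSize ^ 2 *
          ∫ x in (M.node i.castSucc)..(M.node i.succ), (G x - (q i).eval x) ^ 2 := by
          refine Finset.sum_le_sum fun i _ => mul_le_mul_of_nonneg_right ?_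
            (integral_sq_nonneg (M.lt_succ i).le _)
          exact pow_le_pow_left₀ (sub_pos.2 (M.lt_succ i)).le (M.length_le_meshSize i) 2
      _ ≤ M.meshSize ^ 2 * (M.meshSize ^ (2 * (m + σ)) * (C₁ * KA * N ^ 2)) := by
          rw [← Finset.mul_sum]
          exact mul_le_mul_of_nonneg_left hqS (sq_nonneg _)
      _ = _ := by
          rw [mul_pow, mul_pow, Real.sq_sqrt hKA, hH2]
          ring
  obtain ⟨t, S₃, hS₃, ht, htS, hS₃M⟩ : ∃ (t : Fin M.n → ℝ[X]) (S₃ : ℝ), 0 ≤ S₃ ∧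
      (∀ i, (t i).natDegree ≤ k) ∧ ∑ i : Fin M.n,
        ∫ x in (M.node i.castSucc)..(M.node i.succ), (U 0 x - (t i).eval x) ^ 2 ≤ S₃ ^ 2 ∧
      M₀ * S₃ ≤ M₀ * (√c * (H * N)) := by
    rcases hM₀0 with h | h
    · obtain ⟨t, ht, htS⟩ := (hU.lower hab.le hσ).approx_zero.exists_piecewise (by positivity) M
      rw [e1, ← hHsq] at htS
      refine ⟨t, √c * (H * N), by positivity, fun i => natDegree_le_of_degree_lt (ht i) (by omega),
        htS.trans (le_of_eq ?_), le_rfl⟩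
      rw [mul_pow, mul_pow, Real.sq_sqrt hc]
      ring
    -- Without reaction term `M₀ = 0`, so the crude approximation by zero costs nothing.
    · refine ⟨fun _ => 0, √(∑ i : Fin M.n, ∫ x in (M.node i.castSucc)..(M.node i.succ),
        (U 0 x - eval x 0) ^ 2), Real.sqrt_nonneg _, fun _ => by simp, ?_, by simp [h]⟩
      rw [Real.sq_sqrt (Finset.sum_nonneg fun i _ => integral_sq_nonneg (M.lt_succ i).le _)]
  have hest := huh.error_le hab hamin hcoef.le_a₂ ha₂m hM₂ hM₂b hcoef.a₀_nonneg
    hcoef.a₀_bounded hM₀ hM₀b hU0 (hU.memLp 1 (by omega))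
    ((hUu (left_mem_Icc.2 hab.le)).trans hu.left) hpG hGL hpe (by simp [p, hU1b]) hGf
    (S₁ := √(C₁ * KA) * (H * N)) (S₂ := H * N) (by positivity) (by positivity) hS₃
    (fun i => natDegree_le_of_degree_lt (hq i) hk)
    (fun i => natDegree_le_of_degree_lt (hr i) (by omega)) ht hqS'
    (hrS.trans_eq (by ring)) htS
  have hSle : (√(C₁ * KA) * (H * N) + M₂ * (H * N) + M₀ * S₃ * (b - a)) / amin ≤ S * (H * N) := by
    rw [hS, div_mul_eq_mul_div]
    refine div_le_div_of_nonneg_right ?_ hamin.le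
    nlinarith [mul_le_mul_of_nonneg_right hS₃M hba.le]
  have hHN : 0 ≤ H * N := mul_nonneg hH0 hN
  have hsq0 : 0 ≤ √(b - a) := Real.sqrt_nonneg _
  obtain ⟨hd, hn⟩ := hest
  constructor
  · have hcongr : derivError M (k + 1) u uh = √(∑ i, ∫ x in (M.node i.castSucc)..(M.node i.succ),
        ((uh.dw M (k + 1) i).eval x - U 1 x) ^ 2) := by
      rw [derivError]
      congr 1
      refine Finset.sum_congr rfl fun i _ => integral_congr_vol (M.lt_succ i).le ?_
      filter_upwards [ae_vol_sub (M.left_le i.castSucc) (M.le_right i.succ) hUe1] with x hx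
      rw [hx]
    rw [hcongr]
    have : 0 ≤ √(b - a) * S * (H * N) := by positivity
    calc _ ≤ S * (H * N) + H * N := hd.trans (add_le_add_left hSle _)
      _ ≤ _ := by linarith
  · have : Nonempty (Fin (M.n + 1)) := ⟨0⟩
    refine ciSup_le fun i => ?_
    rw [← hUu ⟨M.left_le i, M.le_right i⟩]
    have : 0 ≤ (S + 1) * (H * N) := by positivity
    calc _ ≤ √(b - a) * (S * (H * N)) := (hn i).trans (mul_le_mul_of_nonneg_left hSle hsq0)
      _ ≤ _ := by linarith

end WeakFE

/-! ### Both rates as cases of one estimate -/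

theorem theorem4p4 (a b : ℝ) (hab : a < b) (k : ℕ) (amin : ℝ) (a₂ a₀ : ℝ → ℝ)
    (hcoef : WeakFE.IsCoefficients a b amin a₂ a₀) :
    (∀ s : ℝ, 0 ≤ s → s ≤ k → WeakFE.MemSobolev a b (s + 1) a₂ →
      ∃ C : ℝ, 0 < C ∧ ∀ f u : ℝ → ℝ, MeasureTheory.MemLp f 2 (WeakFE.vol a b) →
        WeakFE.IsExactSolution a b a₂ a₀ f u → WeakFE.MemSobolev a b (s + 2) u →
        ∀ (M : WeakFE.Partition a b) (uh : WeakFE.WeakFunction M.n),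
          WeakFE.IsDiscreteSolution M k (k + 1) a₂ a₀ f uh →
          WeakFE.derivError M (k + 1) u uh
              ≤ C * M.meshSize ^ (s + 1) * WeakFE.sobolevNorm a b (s + 2) u ∧
          WeakFE.nodalError M u uh
              ≤ C * M.meshSize ^ (s + 1) * WeakFE.sobolevNorm a b (s + 2) u) ∧
    (a₀ =ᵐ[WeakFE.vol a b] 0 → WeakFE.MemSobolev a b (k + 2) a₂ →
      ∃ C : ℝ, 0 < C ∧ ∀ f u : ℝ → ℝ, MeasureTheory.MemLp f 2 (WeakFE.vol a b) →
        WeakFE.IsExactSolution a b a₂ a₀ f u → WeakFE.MemSobolev a b (k + 3) u →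
        ∀ (M : WeakFE.Partition a b) (uh : WeakFE.WeakFunction M.n),
          WeakFE.IsDiscreteSolution M k (k + 1) a₂ a₀ f uh →
          WeakFE.derivError M (k + 1) u uh
              ≤ C * M.meshSize ^ (k + 2) * WeakFE.sobolevNorm a b (k + 3) u ∧
          WeakFE.nodalError M u uh
              ≤ C * M.meshSize ^ (k + 2) * WeakFE.sobolevNorm a b (k + 3) u) := by
  refine ⟨fun s hs hsk ha₂ => ?_, fun ha₀ ha₂ => ?_⟩
  -- `m` is the integer part of `s`. If `s` is not an integer then $m<s\le k$ gives $m+1\le k$,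
  -- which pays for the extra coefficients with `δ = 1`.
  · obtain ⟨m, σ, δ, hσ, hs', hk, hk0⟩ : ∃ (m : ℕ) (σ : ℝ) (δ : ℕ), WeakFE.FracOrder σ δ ∧
        s = m + σ ∧ m + 2 * δ ≤ k + 1 ∧ m + δ ≤ k := by
      have hfl := Nat.floor_le hs
      rcases hfl.eq_or_lt with h | h
      · refine ⟨⌊s⌋₊, 0, 0, Or.inl ⟨rfl, rfl⟩, by linarith, ?_, ?_⟩ <;>
        · have : ⌊s⌋₊ ≤ k := by exact_mod_cast h.trans_le hsk
          omega
      · refine ⟨⌊s⌋₊, s - ⌊s⌋₊, 1, Or.inr ⟨by linarith, by linarith [Nat.lt_floor_add_one s], rfl⟩,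
          by ring, ?_, ?_⟩ <;>
        · have : ⌊s⌋₊ < k := by exact_mod_cast h.trans_le hsk
          omega
    have e1 : ((m + 1 : ℕ) : ℝ) + σ = s + 1 := by rw [hs']; push_cast; ring
    have e2 : ((m + 2 : ℕ) : ℝ) + σ = s + 2 := by rw [hs']; push_cast; ring
    have h := WeakFE.exists_error_estimate hab hcoef hσ hk (Or.inl hk0) (by rwa [e1])
    rwa [e2, ← hs'] at h
  · have e1 : ((k + 1 + 1 : ℕ) : ℝ) + 0 = k + 2 := by push_cast; ring
    have e2 : ((k + 1 + 2 : ℕ) : ℝ) + 0 = k + 3 := by push_cast; ring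
    have e3 : ∀ x : ℝ, x ^ (((k + 1 : ℕ) : ℝ) + 0 + 1) = x ^ (k + 2) := fun x => by
      rw [← Real.rpow_natCast]
      congr 1; push_cast; ring
    -- Here $s=k+1$ is an integer: `m + 2 * δ ≤ k + 1` holds with equality, while `m + δ ≤ k` fails
    -- and is replaced by $a_0=0$.
    have h := WeakFE.exists_error_estimate hab hcoef (Or.inl ⟨rfl, rfl⟩) (m := k + 1) (k := k)
      (by omega) (Or.inr ha₀) (by rwa [e1])
    simpa only [e2, e3] using h
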